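/- Let $\mu,\sigma\in\mathbb R$, $T>0$, and let $(\Omega,\mathcal F,(\mathcal F_t)_{t\ge 0},P)$ be a filtered probability space with a Wiener process $W$ relative to $(\mathcal F_t)$, that is, $W$ is an a.s. continuous $(\mathcal F_t)$-martingale with $W(0)=0$ a.s. and $\mathbb E[(W(t)-W(s))^2\mid\mathcal F_s]=t-s$ for $s\le t$. Let $X=(X(t))_{0\le t\le T}$ be an adapted, a.s. continuous process with $\mathbb E|X(0)|^2<\infty$ that solves the geometric Brownian motion equation $$X(t)=X(0)+\mu\int_0^t X(s)\,ds+\int_0^t \sigma X(s)\,dW(s)\quad\text{a.s., for every } t\in[0,T],$$ where the stochastic integral is the Itô integral in its $L^2$ sense (the $L^2(P)$-limit of the integrals of elementary processes that approximate the integrand in $L^2(P\otimes ds)$). For an even integer $N\ge 2$ put $\Delta t=T/N$, $t_i=i\,\Delta t$, $\Delta W_{2n}=W(t_{2n+1})-W(t_{2n})$, $(E^2-1)W_{2n}=W(t_{2n+2})-W(t_{2n})$, and define the numerical scheme by $\tilde X_0=X(0)$ and $$\tilde X_{2n+1}=\alpha_n\tilde X_{2n},\qquad \tilde X_{2n+2}=\beta_n\tilde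 X_{2n},\qquad n=0,1,\dots,\tfrac{N-2}{2},$$ $$\alpha_n=\frac{1-\frac{(\mu\Delta t)^2}{6}-\sigma\frac{\mu\Delta t}{12}(E^2-1)W_{2n}+\sigma\left(1-\frac{\mu\Delta t}{3}\right)\Delta W_{2n}}{1-\mu\Delta t+\frac{(\mu\Delta t)^2}{3}},\qquad \beta_n=\frac{1+\frac{\mu\Delta t}{3}+\frac{4\mu\Delta t}{3}\alpha_n+\sigma(E^2-1)W_{2n}}{1-\frac{\mu\Delta t}{3}}.$$ The scheme is well defined under the condition $\mu\Delta t\ne 3$, hence for all sufficiently large $N$. Then the scheme is mean-square convergent: $$\lim_{\substack{N\to\infty\\ N\text{ even}}}\ \max_{0\le i\le N}\ \mathbb E\,\bigl|X(t_i)-\tilde X_i\bigr|^2=0 .$$ No further condition on $\mu,\sigma,T$ is required; in particular, the convergence holds for all parameters satisfying a mean-square stability condition of the scheme. -/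

import Mathlib

open MeasureTheory Filter Topology
open scoped NNReal ENNReal

noncomputable section

namespace QuadraticScheme

variable {Ω : Type*} {mΩ : MeasurableSpace Ω}

/-- `W` is a standard Wiener process relative to the filtration `ℱ`: it starts at `0`, has almost
surely continuous paths, and is an `ℱ`-martingale with `E[(W t - W s)² | ℱ s] = t - s`. -/
structure IsWienerProcess (ℱ : Filtration ℝ≥0 mΩ) (P : Measure Ω) (W : ℝ≥0 → Ω → ℝ) : Prop where
  zero : ∀ᵐ ω ∂P, W 0 ω = 0
  continuous : ∀ᵐ ω ∂P, Continuous fun t => W t ω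
  martingale : Martingale W ℱ P
  condExp_sq : ∀ s t : ℝ≥0, s ≤ t →
    P[fun ω => (W t ω - W s ω) ^ 2 | ℱ s] =ᵐ[P] fun _ => (t : ℝ) - s

/-- The data of an elementary (simple predictable) process
`∑ j < steps, coef j * 1_(time j, time (j + 1)]`. -/
structure ElementaryProcess (ℱ : Filtration ℝ≥0 mΩ) where
  steps : ℕ
  time : ℕ → ℝ≥0
  coef : ℕ → Ω → ℝ
  monotone_time : Monotone time
  measurable_coef : ∀ j, StronglyMeasurable[ℱ (time j)] (coef j)
  bounded_coef : ∀ j, ∃ C : ℝ, ∀ ω, |coef j ω| ≤ C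

/-- The elementary process as a function of time and chance. -/
def ElementaryProcess.eval {ℱ : Filtration ℝ≥0 mΩ} (φ : ElementaryProcess ℱ) (t : ℝ≥0) (ω : Ω) :
    ℝ :=
  ∑ j ∈ Finset.range φ.steps,
    (Set.Ioc (φ.time j) (φ.time (j + 1))).indicator (fun _ => φ.coef j ω) t

/-- The stochastic integral over `[0, t]` of an elementary process. -/
def ElementaryProcess.integral {ℱ : Filtration ℝ≥0 mΩ} (φ : ElementaryProcess ℱ)
    (W : ℝ≥0 → Ω → ℝ) (t : ℝ≥0) (ω : Ω) : ℝ :=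
  ∑ j ∈ Finset.range φ.steps,
    φ.coef j ω * (W (min t (φ.time (j + 1))) ω - W (min t (φ.time j)) ω)

/-- `I` is (a version of) the Itô integral `∫₀ᵗ H dW`: there are elementary processes `φ k` with
`E ∫₀ᵗ |φ k - H|² ds → 0` whose stochastic integrals converge to `I` in `L²(P)`. -/
def IsItoIntegral (ℱ : Filtration ℝ≥0 mΩ) (P : Measure Ω) (W : ℝ≥0 → Ω → ℝ)
    (H : ℝ≥0 → Ω → ℝ) (t : ℝ≥0) (I : Ω → ℝ) : Prop :=
  MemLp I 2 P ∧ ∃ φ : ℕ → ElementaryProcess ℱ,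
    Tendsto (fun k => ∫⁻ ω, (∫⁻ s in Set.Icc (0 : ℝ) t,
      ‖(φ k).eval s.toNNReal ω - H s.toNNReal ω‖ₑ ^ 2) ∂P) atTop (𝓝 0) ∧
    Tendsto (fun k => ∫⁻ ω, ‖(φ k).integral W t ω - I ω‖ₑ ^ 2 ∂P) atTop (𝓝 0)

/-- `X` is a solution on `[0, T]` of the Itô equation `dX = f(t, X) dt + g(t, X) dW`: it is adapted,
has almost surely continuous paths, and for all `t ≤ T`, almost surely,
`X t = X 0 + ∫₀ᵗ f(s, X s) ds + ∫₀ᵗ g(s, X s) dW s`. -/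
structure IsItoSolution (ℱ : Filtration ℝ≥0 mΩ) (P : Measure Ω) (W : ℝ≥0 → Ω → ℝ)
    (f g : ℝ≥0 → ℝ → ℝ) (T : ℝ≥0) (X : ℝ≥0 → Ω → ℝ) : Prop where
  adapted : ∀ t ≤ T, StronglyMeasurable[ℱ t] (X t)
  continuous : ∀ᵐ ω ∂P, ContinuousOn (fun t => X t ω) (Set.Iic T)
  integrable : ∀ᵐ ω ∂P,
    IntervalIntegrable (fun s : ℝ => f s.toNNReal (X s.toNNReal ω)) volume 0 T
  integral_eq : ∀ t ≤ T, ∃ I : Ω → ℝ,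
    IsItoIntegral ℱ P W (fun s ω => g s (X s ω)) t I ∧
    ∀ᵐ ω ∂P, X t ω =
      X 0 ω + (∫ s in (0 : ℝ)..t, f s.toNNReal (X s.toNNReal ω)) + I ω

/-- The increment of `W` from grid point `i` to grid point `j` of the grid with step `dt`. -/
def gridIncrement (dt : ℝ≥0) (W : ℝ≥0 → Ω → ℝ) (i j : ℕ) (ω : Ω) : ℝ :=
  W (j * dt) ω - W (i * dt) ω

/-- The factor `α n` of the scheme, taking the node `2n` to the node `2n + 1`. -/
def alphaFactor (μ σ : ℝ) (dt : ℝ≥0) (W : ℝ≥0 → Ω → ℝ) (n : ℕ) (ω : Ω) : ℝ :=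
  (1 - (μ * dt) ^ 2 / 6
      - σ * (μ * dt / 12) * gridIncrement dt W (2 * n) (2 * n + 2) ω
      + σ * (1 - μ * dt / 3) * gridIncrement dt W (2 * n) (2 * n + 1) ω) /
    (1 - μ * dt + (μ * dt) ^ 2 / 3)

/-- The factor `β n` of the scheme, taking the node `2n` to the node `2n + 2`. -/
def betaFactor (μ σ : ℝ) (dt : ℝ≥0) (W : ℝ≥0 → Ω → ℝ) (n : ℕ) (ω : Ω) : ℝ :=
  (1 + μ * dt / 3 + 4 * (μ * dt) / 3 * alphaFactor μ σ dt W n ω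
      + σ * gridIncrement dt W (2 * n) (2 * n + 2) ω) /
    (1 - μ * dt / 3)

/-- The approximations at the even nodes `2n`. -/
def evenApprox (μ σ : ℝ) (dt : ℝ≥0) (W : ℝ≥0 → Ω → ℝ) (X₀ : Ω → ℝ) : ℕ → Ω → ℝ
  | 0 => X₀
  | n + 1 => fun ω => betaFactor μ σ dt W n ω * evenApprox μ σ dt W X₀ n ω

/-- The approximation at the node `i`; it is `α n` times the one at `2n` if `i = 2n + 1`. -/
def approx (μ σ : ℝ) (dt : ℝ≥0) (W : ℝ≥0 → Ω → ℝ) (X₀ : Ω → ℝ) (i : ℕ) (ω : Ω) : ℝ :=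
  if Even i then evenApprox μ σ dt W X₀ (i / 2) ω
  else alphaFactor μ σ dt W (i / 2) ω * evenApprox μ σ dt W X₀ (i / 2) ω

/-- The largest mean-square error `max_{0 ≤ i ≤ N} E |X(t i) - X̃ i|²` over the nodes
`t i = i T / N` of the regular grid with `N` steps, where the scheme starts from `X 0`. -/
def maxMeanSquareError (P : Measure Ω) (μ σ : ℝ) (T : ℝ≥0) (W X : ℝ≥0 → Ω → ℝ) (N : ℕ) : ℝ≥0∞ :=
  ⨆ i ∈ Finset.range (N + 1),
    ∫⁻ ω, ‖X (i * (T / N)) ω - approx μ σ (T / N) W (X 0) i ω‖ₑ ^ 2 ∂P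

end QuadraticScheme

end

/-!
The scheme is affine in the increments of `W`, so its mean-square error involves only first and
second conditional moments of increments, which the martingale property and
`E[(W t - W s)² | ℱ s] = t - s` provide. Neither the Gaussian law of `W` nor Itô's formula nor the
explicit solution of the equation is needed.

*The solution.* Weighted increments of `W` have covariance equal to the overlap of their intervals
(`IsWienerProcess.integral_increment_mul_increment`). This gives the Itô isometry for finite sums of
weighted increments in any position, hence for differences of elementary processes without a common
refinement (`StepProcess.meanSq_integral_sub`), and so the Itô integrals at different times are
limits of one sequence (`IsItoSolution.exists_elementaryProcess`). Consequently, on a step from `s`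
to `t`, the solution `X` has second moments bounded uniformly on `[0, T]`, and `X t - X s` is the
sum of a drift `μ (t - s) X s + O((t - s)^(3/2))` and of an increment
`σ X s (W t - W s) + O(t - s)` orthogonal to `ℱ s`, in `L²`
(`IsItoSolution.exists_hasStepExpansion`). Square integrability of `X` is not assumed: for `σ ≠ 0`
it is forced by the definition of the Itô integral, and for `σ = 0` it follows from Gronwall's lemma
applied to each path.

*The scheme.* Write `β n = a + b (W u - W s) + c (W t - W s)` with `s`, `u`, `t` the nodes `2n`,
`2n + 1`, `2n + 2` and `d` the step size. Then `a = 1 + 2 μ d + O(d²)`, `b → 0` and `c → σ`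
as `d → 0`. The error at the node `2n + 2` is `a` times the error at `2n`, plus a part orthogonal to
`ℱ s`, plus a remainder; hence its mean square is at most `1 + O(d)` times the one at `2n`, plus
`o(d)` (`HasStepExpansion.meanSq_step_le`). Iterating over the `T / (2 d)` double steps bounds the
error at all even nodes by `o(1)`, and an odd node adds one step whose own error tends to `0`.
-/

namespace QuadraticScheme

/-! ### Mean squares -/

section MeanSq

variable {α : Type*} {mα : MeasurableSpace α} {ν : Measure α}

/-- The mean square `∫ |f|² dν`, as an extended nonnegative number, so that no integrability is
needed to speak of it. -/
noncomputable def meanSq (ν : Measure α) (f : α → ℝ) : ℝ≥0∞ := ∫⁻ x, ‖f x‖ₑ ^ 2 ∂ν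

theorem enorm_sq_eq_ofReal (x : ℝ) : ‖x‖ₑ ^ 2 = ENNReal.ofReal (x ^ 2) := by
  rw [Real.enorm_eq_ofReal_abs, ← ENNReal.ofReal_pow (abs_nonneg _), sq_abs]

theorem enorm_add_sq_le (x y : ℝ) : ‖x + y‖ₑ ^ 2 ≤ 2 * ‖x‖ₑ ^ 2 + 2 * ‖y‖ₑ ^ 2 := by
  simp only [enorm_sq_eq_ofReal]
  rw [← ENNReal.ofReal_ofNat 2, ← ENNReal.ofReal_mul (by norm_num),
    ← ENNReal.ofReal_mul (by norm_num), ← ENNReal.ofReal_add (by positivity) (by positivity)]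
  apply ENNReal.ofReal_le_ofReal
  nlinarith [sq_nonneg (x - y)]

theorem meanSq_congr {f g : α → ℝ} (h : f =ᵐ[ν] g) : meanSq ν f = meanSq ν g :=
  lintegral_congr_ae (h.mono fun x hx => by simp only [hx])

theorem meanSq_add_le {f g : α → ℝ} (hf : AEStronglyMeasurable f ν) :
    meanSq ν (fun x => f x + g x) ≤ 2 * meanSq ν f + 2 * meanSq ν g := by
  unfold meanSq
  rw [← lintegral_const_mul' _ _ (by simp), ← lintegral_const_mul' _ _ (by simp),
    ← lintegral_add_left' ((hf.enorm.pow_const 2).const_mul 2)]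
  exact lintegral_mono fun x => enorm_add_sq_le _ _

theorem meanSq_sub_le {f g : α → ℝ} (hf : AEStronglyMeasurable f ν) :
    meanSq ν (fun x => f x - g x) ≤ 2 * meanSq ν f + 2 * meanSq ν g := by
  have := meanSq_add_le (g := fun x => -g x) hf
  simpa [meanSq, sub_eq_add_neg] using this

theorem meanSq_sub_comm (f g : α → ℝ) :
    meanSq ν (fun x => f x - g x) = meanSq ν (fun x => g x - f x) := by
  unfold meanSq
  congr 1 with x
  simp only [← neg_sub (g x), enorm_neg]

theorem meanSq_const_mul (c : ℝ) (f : α → ℝ) :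
    meanSq ν (fun x => c * f x) = ENNReal.ofReal (c ^ 2) * meanSq ν f := by
  unfold meanSq
  rw [← lintegral_const_mul' _ _ (by simp)]
  congr 1 with x
  rw [enorm_mul, mul_pow, enorm_sq_eq_ofReal c]

theorem memLp_two_iff_meanSq_lt_top {f : α → ℝ} (hf : AEStronglyMeasurable f ν) :
    MemLp f 2 ν ↔ meanSq ν f < ∞ := by
  have h := eLpNorm_lt_top_iff_lintegral_rpow_enorm_lt_top (f := f) (μ := ν)
    (p := 2) (by norm_num) (by norm_num)
  simp only [ENNReal.toReal_ofNat, ENNReal.rpow_ofNat] at h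
  rw [MemLp, h]
  exact ⟨fun h => h.2, fun h => ⟨hf, h⟩⟩

theorem meanSq_eq_ofReal {f : α → ℝ} (hf : MemLp f 2 ν) :
    meanSq ν f = ENNReal.ofReal (∫ x, f x ^ 2 ∂ν) := by
  rw [ofReal_integral_eq_lintegral_ofReal hf.integrable_sq (ae_of_all _ fun x => sq_nonneg _)]
  simp only [meanSq, enorm_sq_eq_ofReal]

theorem integrable_mul_of_memLp_two {f g : α → ℝ} (hf : MemLp f 2 ν) (hg : MemLp g 2 ν) :
    Integrable (fun x => f x * g x) ν :=
  hf.integrable_mul hg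

theorem meanSq_add_of_orthogonal {f g : α → ℝ} (hf : MemLp f 2 ν) (hg : MemLp g 2 ν)
    (h : ∫ x, f x * g x ∂ν = 0) :
    meanSq ν (fun x => f x + g x) = meanSq ν f + meanSq ν g := by
  have hfg := integrable_mul_of_memLp_two hf hg
  have hadd : MemLp (fun x => f x + g x) 2 ν := hf.add hg
  rw [meanSq_eq_ofReal hf, meanSq_eq_ofReal hg, meanSq_eq_ofReal hadd,
    ← ENNReal.ofReal_add (integral_nonneg fun x => sq_nonneg _)
      (integral_nonneg fun x => sq_nonneg _)]
  congr 1
  have : ∀ x, (f x + g x) ^ 2 = (f x ^ 2 + 2 * (f x * g x)) + g x ^ 2 := fun x => by ring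
  simp only [this]
  rw [integral_add (f := fun x => f x ^ 2 + 2 * (f x * g x))
      (hf.integrable_sq.add (hfg.const_mul 2)) hg.integrable_sq,
    integral_add hf.integrable_sq (hfg.const_mul 2), integral_const_mul, h]
  ring

/-- The weighted parallelogram bound `|f + g|² ≤ (1 + h) |f|² + (1 + 1 / h) |g|²`. -/
theorem meanSq_add_le_weighted {f g : α → ℝ} (hf : AEStronglyMeasurable f ν) {h : ℝ} (hh : 0 < h) :
    meanSq ν (fun x => f x + g x) ≤
      ENNReal.ofReal (1 + h) * meanSq ν f + ENNReal.ofReal (1 + 1 / h) * meanSq ν g := by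
  unfold meanSq
  rw [← lintegral_const_mul' _ _ (by simp), ← lintegral_const_mul' _ _ (by simp),
    ← lintegral_add_left' ((hf.enorm.pow_const 2).const_mul _)]
  refine lintegral_mono fun x => ?_
  simp only [enorm_sq_eq_ofReal]
  rw [← ENNReal.ofReal_mul (by positivity), ← ENNReal.ofReal_mul (by positivity),
    ← ENNReal.ofReal_add (by positivity) (by positivity)]
  apply ENNReal.ofReal_le_ofReal
  have : (1 + h) * f x ^ 2 + (1 + 1 / h) * g x ^ 2 - (f x + g x) ^ 2
      = (h * f x - g x) ^ 2 / h := by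
    field_simp
    ring
  have h2 : 0 ≤ (h * f x - g x) ^ 2 / h := by positivity
  linarith

/-- Orthogonality to `f` passes to limits in mean square. -/
theorem integral_mul_eq_zero_of_tendsto {f g : α → ℝ} {u : ℕ → α → ℝ} (hf : MemLp f 2 ν)
    (hg : MemLp g 2 ν) (hu : ∀ k, MemLp (u k) 2 ν) (h0 : ∀ k, ∫ x, f x * u k x ∂ν = 0)
    (h : Tendsto (fun k => meanSq ν (fun x => u k x - g x)) atTop (𝓝 0)) :
    ∫ x, f x * g x ∂ν = 0 := by
  have key : ∀ k, ‖∫ x, f x * g x ∂ν‖ₑ ≤ (meanSq ν f) ^ (1 / 2 : ℝ) *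
      (meanSq ν (fun x => u k x - g x)) ^ (1 / 2 : ℝ) := by
    intro k
    have e : ∫ x, f x * g x ∂ν = ∫ x, f x * (g x - u k x) ∂ν := by
      simp only [mul_sub]
      rw [integral_sub (integrable_mul_of_memLp_two hf hg)
        (integrable_mul_of_memLp_two hf (hu k)), h0 k, sub_zero]
    rw [e, meanSq_sub_comm]
    refine (enorm_integral_le_lintegral_enorm _).trans ?_
    have := ENNReal.lintegral_mul_le_Lp_mul_Lq ν Real.HolderConjugate.two_two
      hf.1.enorm (hg.1.sub (hu k).1).enorm
    simpa [meanSq, enorm_mul] using this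
  have hlim : Tendsto (fun k => (meanSq ν f) ^ (1 / 2 : ℝ) *
      (meanSq ν (fun x => u k x - g x)) ^ (1 / 2 : ℝ)) atTop (𝓝 0) := by
    have h1 := (ENNReal.continuous_rpow_const (y := (1 / 2 : ℝ))).tendsto 0 |>.comp h
    rw [ENNReal.zero_rpow_of_pos (by norm_num)] at h1
    have h2 := ENNReal.Tendsto.const_mul (a := (meanSq ν f) ^ (1 / 2 : ℝ)) h1
      (Or.inr (ENNReal.rpow_ne_top_of_nonneg (by norm_num)
        ((memLp_two_iff_meanSq_lt_top hf.1).1 hf).ne))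
    simpa using h2
  have := ge_of_tendsto' hlim key
  simpa using this

theorem tendsto_const_mul_zero (c : ℝ≥0) {u : ℕ → ℝ≥0∞} (h : Tendsto u atTop (𝓝 0)) :
    Tendsto (fun k => (c : ℝ≥0∞) * u k) atTop (𝓝 0) := by
  simpa using ENNReal.Tendsto.const_mul h (Or.inr (ENNReal.coe_ne_top (r := c)))

theorem tendsto_add_zero {u v : ℕ → ℝ≥0∞} (hu : Tendsto u atTop (𝓝 0))
    (hv : Tendsto v atTop (𝓝 0)) : Tendsto (fun k => u k + v k) atTop (𝓝 0) := by
  simpa using hu.add hv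

end MeanSq

/-! ### Increments of the Wiener process -/

section Wiener

variable {Ω : Type*} {mΩ : MeasurableSpace Ω} {P : Measure Ω}
  {ℱ : Filtration ℝ≥0 mΩ} {W : ℝ≥0 → Ω → ℝ}

theorem IsWienerProcess.stronglyMeasurable_increment (hW : IsWienerProcess ℱ P W) {s t u : ℝ≥0}
    (hs : s ≤ u) (ht : t ≤ u) : StronglyMeasurable[ℱ u] fun ω => W t ω - W s ω :=
  ((hW.martingale.stronglyMeasurable t).mono (ℱ.mono ht)).sub
    ((hW.martingale.stronglyMeasurable s).mono (ℱ.mono hs))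

theorem IsWienerProcess.condExp_increment (hW : IsWienerProcess ℱ P W) {s t : ℝ≥0} (hst : s ≤ t) :
    P[fun ω => W t ω - W s ω | ℱ s] =ᵐ[P] 0 := by
  have h := condExp_sub (hW.martingale.integrable t) (hW.martingale.integrable s) (ℱ s)
  filter_upwards [h, hW.martingale.condExp_ae_eq hst, hW.martingale.condExp_ae_eq (le_refl s)]
    with ω h1 h2 h3
  have h4 : P[fun ω => W t ω - W s ω | ℱ s] ω = P[W t - W s | ℱ s] ω := rfl
  rw [h4, h1, Pi.sub_apply, h2, h3]
  simp

variable [IsProbabilityMeasure P]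

theorem IsWienerProcess.memLp_increment (hW : IsWienerProcess ℱ P W) {s t : ℝ≥0} (hst : s ≤ t) :
    MemLp (fun ω => W t ω - W s ω) 2 P := by
  rcases hst.eq_or_lt with rfl | hlt
  · simp
  have hm : StronglyMeasurable fun ω => W t ω - W s ω :=
    (hW.stronglyMeasurable_increment hst le_rfl).mono (ℱ.le t)
  rw [memLp_two_iff_integrable_sq hm.aestronglyMeasurable]
  -- a non-integrable square would have conditional expectation `0` instead of `t - s > 0`
  by_contra hcon
  have h := hW.condExp_sq s t hst
  rw [condExp_of_not_integrable hcon] at h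
  obtain ⟨ω, hω⟩ := h.exists
  have : (s : ℝ) < t := by exact_mod_cast hlt
  simp only [Pi.zero_apply] at hω
  linarith

theorem IsWienerProcess.integral_mul_increment (hW : IsWienerProcess ℱ P W) {s t : ℝ≥0}
    (hst : s ≤ t) {Z : Ω → ℝ} (hZ : StronglyMeasurable[ℱ s] Z)
    (hi : Integrable (fun ω => Z ω * (W t ω - W s ω)) P) :
    ∫ ω, Z ω * (W t ω - W s ω) ∂P = 0 := by
  rw [← integral_condExp (ℱ.le s)]
  have h := condExp_mul_of_stronglyMeasurable_left (μ := P) (g := fun ω => W t ω - W s ω) hZ hi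
    ((hW.memLp_increment hst).integrable (by norm_num))
  refine integral_eq_zero_of_ae (h.trans ?_)
  filter_upwards [hW.condExp_increment hst] with ω hω
  simp [hω]

theorem IsWienerProcess.integral_mul_increment_sq (hW : IsWienerProcess ℱ P W) {s t : ℝ≥0}
    (hst : s ≤ t) {Z : Ω → ℝ} (hZ : StronglyMeasurable[ℱ s] Z)
    (hi : Integrable (fun ω => Z ω * (W t ω - W s ω) ^ 2) P) :
    ∫ ω, Z ω * (W t ω - W s ω) ^ 2 ∂P = (∫ ω, Z ω ∂P) * (t - s) := by
  rw [← integral_condExp (ℱ.le s)]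
  have h := condExp_mul_of_stronglyMeasurable_left (μ := P)
    (g := fun ω => (W t ω - W s ω) ^ 2) hZ hi (hW.memLp_increment hst).integrable_sq
  rw [← integral_mul_const]
  refine integral_congr_ae (h.trans ?_)
  filter_upwards [hW.condExp_sq s t hst] with ω hω
  simp [hω]

/-- The second moment of an increment weighted by a factor known at its beginning. The factor need
not be bounded or square integrable: the measures `(W t - W s)² P` and `(t - s) P` agree on
`ℱ s`. -/
theorem IsWienerProcess.meanSq_mul_increment (hW : IsWienerProcess ℱ P W) {s t : ℝ≥0}
    (hst : s ≤ t) {Z : Ω → ℝ} (hZ : StronglyMeasurable[ℱ s] Z) :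
    meanSq P (fun ω => Z ω * (W t ω - W s ω)) = ENNReal.ofReal (t - s) * meanSq P Z := by
  set g : Ω → ℝ≥0∞ := fun ω => ‖W t ω - W s ω‖ₑ ^ 2 with hg
  have hgm : Measurable g := (((hW.stronglyMeasurable_increment hst le_rfl).mono
    (ℱ.le t)).measurable.enorm).pow_const 2
  have hd : (P.withDensity g).trim (ℱ.le s) = (ENNReal.ofReal (t - s) • P).trim (ℱ.le s) := by
    refine @Measure.ext _ (ℱ s) _ _ fun A hA => ?_
    rw [trim_measurableSet_eq _ hA, trim_measurableSet_eq _ hA,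
      withDensity_apply _ (ℱ.le s _ hA)]
    have hint := (hW.memLp_increment hst).integrable_sq
    have h1 := setIntegral_condExp (ℱ.le s) hint hA
    rw [setIntegral_congr_ae (ℱ.le s _ hA)
      ((hW.condExp_sq s t hst).mono fun ω h _ => h)] at h1
    simp only [hg, enorm_sq_eq_ofReal]
    rw [← ofReal_integral_eq_lintegral_ofReal hint.integrableOn
      (ae_of_all _ fun x => sq_nonneg _), ← h1]
    have h0 : (0 : ℝ) ≤ t - s := sub_nonneg.2 (by exact_mod_cast hst)
    simp only [setIntegral_const, smul_eq_mul, Measure.smul_apply, measureReal_def]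
    rw [ENNReal.ofReal_mul ENNReal.toReal_nonneg, ENNReal.ofReal_toReal (by simp), mul_comm]
  have hZm : Measurable[ℱ s] fun ω => ‖Z ω‖ₑ ^ 2 := hZ.enorm.pow_const 2
  calc meanSq P (fun ω => Z ω * (W t ω - W s ω)) = ∫⁻ ω, (g * fun ω => ‖Z ω‖ₑ ^ 2) ω ∂P := by
        unfold meanSq
        congr 1 with ω
        simp [hg, enorm_mul, mul_pow, mul_comm]
    _ = ∫⁻ ω, ‖Z ω‖ₑ ^ 2 ∂(P.withDensity g) := by
        rw [lintegral_withDensity_eq_lintegral_mul _ hgm (hZm.mono (ℱ.le s) le_rfl)]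
    _ = ∫⁻ ω, ‖Z ω‖ₑ ^ 2 ∂(ENNReal.ofReal (t - s) • P) := by
        rw [← lintegral_trim (ℱ.le s) hZm, hd, lintegral_trim (ℱ.le s) hZm]
    _ = _ := by rw [lintegral_smul_measure]; rfl

theorem IsWienerProcess.memLp_mul_increment (hW : IsWienerProcess ℱ P W) {s t : ℝ≥0}
    (hst : s ≤ t) {Z : Ω → ℝ} (hZ : StronglyMeasurable[ℱ s] Z) (hZ2 : MemLp Z 2 P) :
    MemLp (fun ω => Z ω * (W t ω - W s ω)) 2 P := by
  have hm : StronglyMeasurable fun ω => Z ω * (W t ω - W s ω) :=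
    (hZ.mono (ℱ.le s)).mul ((hW.stronglyMeasurable_increment hst le_rfl).mono (ℱ.le t))
  rw [memLp_two_iff_meanSq_lt_top hm.aestronglyMeasurable, hW.meanSq_mul_increment hst hZ]
  exact ENNReal.mul_lt_top (by simp) ((memLp_two_iff_meanSq_lt_top hZ2.1).1 hZ2)

/-- Weighted increments over consecutive intervals are orthogonal. -/
theorem IsWienerProcess.integral_increment_mul_increment_of_le (hW : IsWienerProcess ℱ P W)
    {s t u v : ℝ≥0} (hst : s ≤ t) (htu : t ≤ u) (huv : u ≤ v) {a b : Ω → ℝ}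
    (ha : StronglyMeasurable[ℱ s] a) (ha2 : MemLp a 2 P)
    (hb : StronglyMeasurable[ℱ u] b) (hb2 : MemLp b 2 P) :
    ∫ ω, (a ω * (W t ω - W s ω)) * (b ω * (W v ω - W u ω)) ∂P = 0 := by
  have hi := (hW.memLp_mul_increment hst ha ha2).integrable_mul (hW.memLp_mul_increment huv hb hb2)
  have hm : StronglyMeasurable[ℱ u] fun ω => a ω * (W t ω - W s ω) * b ω :=
    ((ha.mono (ℱ.mono (hst.trans htu))).mul
      (hW.stronglyMeasurable_increment (hst.trans htu) htu)).mul hb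
  have e : ∀ ω, (a ω * (W t ω - W s ω)) * (b ω * (W v ω - W u ω)) =
    a ω * (W t ω - W s ω) * b ω * (W v ω - W u ω) := fun ω => by ring
  simp only [e]
  refine hW.integral_mul_increment huv hm (hi.congr (ae_of_all _ fun ω => ?_))
  exact e ω

theorem IsWienerProcess.integral_increment_mul_increment_self (hW : IsWienerProcess ℱ P W)
    {u v : ℝ≥0} (huv : u ≤ v) {a b : Ω → ℝ}
    (ha : StronglyMeasurable[ℱ u] a) (ha2 : MemLp a 2 P)
    (hb : StronglyMeasurable[ℱ u] b) (hb2 : MemLp b 2 P) :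
    ∫ ω, (a ω * (W v ω - W u ω)) * (b ω * (W v ω - W u ω)) ∂P =
      (∫ ω, a ω * b ω ∂P) * (v - u) := by
  have hi := (hW.memLp_mul_increment huv ha ha2).integrable_mul (hW.memLp_mul_increment huv hb hb2)
  have e : ∀ ω, (a ω * (W v ω - W u ω)) * (b ω * (W v ω - W u ω)) =
    a ω * b ω * (W v ω - W u ω) ^ 2 := fun ω => by ring
  simp only [e]
  refine hW.integral_mul_increment_sq huv (ha.mul hb) (hi.congr (ae_of_all _ fun ω => ?_))
  exact e ω

/-- Covariance of weighted increments: only the overlap of the two intervals counts. The weights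
need to be known at the beginning of their interval only if the interval is not empty. -/
theorem IsWienerProcess.integral_increment_mul_increment (hW : IsWienerProcess ℱ P W)
    {s t u v : ℝ≥0} (hst : s ≤ t) (huv : u ≤ v) {a b : Ω → ℝ}
    (ha : s < t → StronglyMeasurable[ℱ s] a) (ha2 : MemLp a 2 P)
    (hb : u < v → StronglyMeasurable[ℱ u] b) (hb2 : MemLp b 2 P) :
    ∫ ω, (a ω * (W t ω - W s ω)) * (b ω * (W v ω - W u ω)) ∂P =
      (∫ ω, a ω * b ω ∂P) * max 0 (min (t : ℝ) v - max (s : ℝ) u) := by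
  wlog hsu : s ≤ u generalizing s t u v a b
  · have := this huv hst hb hb2 ha ha2 (le_of_not_ge hsu)
    rw [min_comm, max_comm (s : ℝ)]
    simpa only [mul_comm] using this
  have huv' : (u : ℝ) ≤ v := by exact_mod_cast huv
  have hsu' : (s : ℝ) ≤ u := by exact_mod_cast hsu
  rcases hst.eq_or_lt with rfl | hst1
  · simp [hsu']
  rcases huv.eq_or_lt with rfl | huv1
  · simp [hsu']
  replace ha := ha hst1
  replace hb := hb huv1
  rw [max_eq_right hsu']
  rcases le_total t u with htu | hut
  · have htu' : (t : ℝ) ≤ u := by exact_mod_cast htu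
    rw [hW.integral_increment_mul_increment_of_le hst htu huv ha ha2 hb hb2,
      min_eq_left (htu'.trans huv'), max_eq_left (by linarith), mul_zero]
  have hut' : (u : ℝ) ≤ t := by exact_mod_cast hut
  have hau : StronglyMeasurable[ℱ u] a := ha.mono (ℱ.mono hsu)
  have hv2 := hW.memLp_mul_increment huv hb hb2
  -- the part of the first increment before time `u` does not contribute
  have e1 : ∫ ω, (a ω * (W t ω - W s ω)) * (b ω * (W v ω - W u ω)) ∂P =
      ∫ ω, (a ω * (W t ω - W u ω)) * (b ω * (W v ω - W u ω)) ∂P := by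
    have h := hW.integral_increment_mul_increment_of_le hsu le_rfl huv ha ha2 hb hb2
    rw [← zero_add (∫ ω, (a ω * (W t ω - W u ω)) * (b ω * (W v ω - W u ω)) ∂P), ← h,
      ← integral_add (integrable_mul_of_memLp_two (hW.memLp_mul_increment hsu ha ha2) hv2)
        (integrable_mul_of_memLp_two (hW.memLp_mul_increment hut hau ha2) hv2)]
    congr 1 with ω
    ring
  rw [e1]
  rcases le_total t v with htv | hvt
  · have htv' : (t : ℝ) ≤ v := by exact_mod_cast htv
    have hbt := hb.mono (ℱ.mono hut)
    have h := hW.integral_increment_mul_increment_of_le hut le_rfl htv hau ha2 hbt hb2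
    rw [min_eq_left htv', max_eq_right (by linarith),
      ← hW.integral_increment_mul_increment_self hut hau ha2 hb hb2,
      ← add_zero (∫ ω, (a ω * (W t ω - W u ω)) * (b ω * (W t ω - W u ω)) ∂P), ← h,
      ← integral_add (integrable_mul_of_memLp_two (hW.memLp_mul_increment hut hau ha2)
        (hW.memLp_mul_increment hut hb hb2)) (integrable_mul_of_memLp_two
        (hW.memLp_mul_increment hut hau ha2) (hW.memLp_mul_increment htv hbt hb2))]
    congr 1 with ω
    ring
  · have hvt' : (v : ℝ) ≤ t := by exact_mod_cast hvt
    have hat := hau.mono (ℱ.mono huv)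
    have h := hW.integral_increment_mul_increment_of_le huv le_rfl hvt hb hb2 hat ha2
    rw [min_eq_right hvt', max_eq_right (by linarith),
      ← hW.integral_increment_mul_increment_self huv hau ha2 hb hb2,
      ← add_zero (∫ ω, (a ω * (W v ω - W u ω)) * (b ω * (W v ω - W u ω)) ∂P), ← h,
      ← integral_add (integrable_mul_of_memLp_two
        (hW.memLp_mul_increment huv hau ha2) hv2)
        (integrable_mul_of_memLp_two hv2 (hW.memLp_mul_increment hvt hat ha2))]
    congr 1 with ω
    ring

end Wiener

/-! ### The Itô isometry -/

section Isometry

variable {Ω : Type*} {mΩ : MeasurableSpace Ω} {P : Measure Ω}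
  {ℱ : Filtration ℝ≥0 mΩ} {W : ℝ≥0 → Ω → ℝ}

theorem memLp_two_indicator_Ioc (a b c : ℝ) :
    MemLp ((Set.Ioc a b).indicator fun _ : ℝ => c) 2 volume :=
  memLp_indicator_const 2 measurableSet_Ioc c (Or.inr (by simp))

theorem integral_indicator_Ioc_mul_indicator_Ioc (a b c d x y : ℝ) :
    ∫ r : ℝ, (Set.Ioc a b).indicator (fun _ => x) r * (Set.Ioc c d).indicator (fun _ => y) r =
      x * y * max 0 (min b d - max a c) := by
  have : ∀ r : ℝ, (Set.Ioc a b).indicator (fun _ => x) r * (Set.Ioc c d).indicator (fun _ => y) r =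
      (Set.Ioc (max a c) (min b d)).indicator (fun _ => x * y) r := by
    intro r
    have h := Set.inter_indicator_mul (s := Set.Ioc a b) (t := Set.Ioc c d)
      (fun _ : ℝ => x) (fun _ => y) r
    rw [Set.Ioc_inter_Ioc] at h
    exact h.symm
  simp only [this]
  rw [integral_indicator_const _ measurableSet_Ioc]
  simp only [Real.volume_real_Ioc, smul_eq_mul]
  rw [max_comm 0, mul_comm]

/-- A finite sum of square integrable weights on intervals `(lo j, hi j]`, which may overlap and
need not be ordered. A weight is known at the beginning of its interval unless the interval is
empty. -/
structure StepProcess (ℱ : Filtration ℝ≥0 mΩ) (P : Measure Ω) where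
  steps : ℕ
  lo : ℕ → ℝ≥0
  hi : ℕ → ℝ≥0
  coef : ℕ → Ω → ℝ
  lo_le_hi : ∀ j, lo j ≤ hi j
  measurable_coef : ∀ j, lo j < hi j → StronglyMeasurable[ℱ (lo j)] (coef j)
  memLp_coef : ∀ j, MemLp (coef j) 2 P

namespace StepProcess

/-- The step process as a function of (real) time and chance. -/
noncomputable def eval (φ : StepProcess ℱ P) (r : ℝ) (ω : Ω) : ℝ :=
  ∑ j ∈ Finset.range φ.steps, (Set.Ioc (φ.lo j : ℝ) (φ.hi j)).indicator (fun _ => φ.coef j ω) r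

/-- The stochastic integral of a step process over the whole time axis. -/
noncomputable def integral (φ : StepProcess ℱ P) (W : ℝ≥0 → Ω → ℝ) (ω : Ω) : ℝ :=
  ∑ j ∈ Finset.range φ.steps, φ.coef j ω * (W (φ.hi j) ω - W (φ.lo j) ω)

/-- The step process with a single step. -/
def single {p q : ℝ≥0} (hpq : p ≤ q) {Z : Ω → ℝ} (hZ : StronglyMeasurable[ℱ p] Z)
    (hZ2 : MemLp Z 2 P) : StepProcess ℱ P where
  steps := 1
  lo _ := p
  hi _ := q
  coef _ := Z
  lo_le_hi _ := hpq
  measurable_coef _ _ := hZ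
  memLp_coef _ := hZ2

theorem integral_single {p q : ℝ≥0} (hpq : p ≤ q) {Z : Ω → ℝ} (hZ : StronglyMeasurable[ℱ p] Z)
    (hZ2 : MemLp Z 2 P) (ω : Ω) :
    (single hpq hZ hZ2).integral W ω = Z ω * (W q ω - W p ω) := by
  simp [single, integral]

theorem eval_single {p q : ℝ≥0} (hpq : p ≤ q) {Z : Ω → ℝ} (hZ : StronglyMeasurable[ℱ p] Z)
    (hZ2 : MemLp Z 2 P) (r : ℝ) (ω : Ω) :
    (single hpq hZ hZ2).eval r ω = (Set.Ioc (p : ℝ) q).indicator (fun _ => Z ω) r := by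
  simp [single, eval]

end StepProcess

variable [IsProbabilityMeasure P]

/-- A sum of weighted increments over intervals that may overlap, in any order: its mean square is
that of the step process with the same weights on the same intervals. -/
theorem IsWienerProcess.meanSq_sum_increment (hW : IsWienerProcess ℱ P W) {ι : Type*}
    (A : Finset ι) (c : ι → Ω → ℝ) (lo hi : ι → ℝ≥0) (hle : ∀ i, lo i ≤ hi i)
    (hc : ∀ i, lo i < hi i → StronglyMeasurable[ℱ (lo i)] (c i)) (hc2 : ∀ i, MemLp (c i) 2 P)
    (hm : ∀ i, MemLp (fun ω => c i ω * (W (hi i) ω - W (lo i) ω)) 2 P) :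
    meanSq P (fun ω => ∑ i ∈ A, c i ω * (W (hi i) ω - W (lo i) ω)) =
      ∫⁻ ω, meanSq volume (fun r : ℝ =>
        ∑ i ∈ A, (Set.Ioc (lo i : ℝ) (hi i)).indicator (fun _ => c i ω) r) ∂P := by
  set len : ι → ι → ℝ := fun i j => max 0 (min (hi i : ℝ) (hi j) - max (lo i : ℝ) (lo j))
  have hR : ∀ ω, ∫ r : ℝ, (∑ i ∈ A, (Set.Ioc (lo i : ℝ) (hi i)).indicator (fun _ => c i ω) r) ^ 2 =
      ∑ i ∈ A, ∑ j ∈ A, c i ω * c j ω * len i j := by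
    intro ω
    simp only [sq, Finset.sum_mul_sum]
    rw [integral_finsetSum _ fun i _ => integrable_finsetSum _ fun j _ =>
      integrable_mul_of_memLp_two (memLp_two_indicator_Ioc _ _ _) (memLp_two_indicator_Ioc _ _ _)]
    refine Finset.sum_congr rfl fun i _ => ?_
    rw [integral_finsetSum _ fun j _ =>
      integrable_mul_of_memLp_two (memLp_two_indicator_Ioc _ _ _) (memLp_two_indicator_Ioc _ _ _)]
    exact Finset.sum_congr rfl fun j _ => integral_indicator_Ioc_mul_indicator_Ioc _ _ _ _ _ _
  have hint : ∀ i j, Integrable (fun ω => c i ω * c j ω * len i j) P := fun i j =>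
    (integrable_mul_of_memLp_two (hc2 i) (hc2 j)).mul_const _
  have hL : ∫ ω, (∑ i ∈ A, c i ω * (W (hi i) ω - W (lo i) ω)) ^ 2 ∂P =
      ∫ ω, ∑ i ∈ A, ∑ j ∈ A, c i ω * c j ω * len i j ∂P := by
    simp only [sq, Finset.sum_mul_sum]
    rw [integral_finsetSum _ fun i _ => integrable_finsetSum _ fun j _ =>
      integrable_mul_of_memLp_two (hm i) (hm j), integral_finsetSum _ fun i _ =>
      integrable_finsetSum _ fun j _ => hint i j]
    refine Finset.sum_congr rfl fun i _ => ?_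
    rw [integral_finsetSum _ fun j _ => integrable_mul_of_memLp_two (hm i) (hm j),
      integral_finsetSum _ fun j _ => hint i j]
    refine Finset.sum_congr rfl fun j _ => ?_
    rw [hW.integral_increment_mul_increment (hle i) (hle j) (hc i) (hc2 i) (hc j) (hc2 j),
      integral_mul_const]
  rw [meanSq_eq_ofReal (memLp_finsetSum _ fun i _ => hm i), hL,
    ofReal_integral_eq_lintegral_ofReal (integrable_finsetSum _ fun i _ =>
      integrable_finsetSum _ fun j _ => hint i j) (ae_of_all _ fun ω => by
        simp only [← hR, Pi.zero_apply]
        exact integral_nonneg fun r => sq_nonneg _)]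
  congr 1 with ω
  rw [meanSq_eq_ofReal (memLp_finsetSum _ fun i _ => memLp_two_indicator_Ioc _ _ _), hR]

namespace StepProcess

theorem memLp_term (φ : StepProcess ℱ P) (hW : IsWienerProcess ℱ P W) (j : ℕ) :
    MemLp (fun ω => φ.coef j ω * (W (φ.hi j) ω - W (φ.lo j) ω)) 2 P := by
  rcases (φ.lo_le_hi j).eq_or_lt with h | h
  · simp [h]
  · exact hW.memLp_mul_increment h.le (φ.measurable_coef j h) (φ.memLp_coef j)

theorem memLp_integral (φ : StepProcess ℱ P) (hW : IsWienerProcess ℱ P W) :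
    MemLp (φ.integral W) 2 P :=
  memLp_finsetSum _ fun j _ => φ.memLp_term hW j

/-- Itô isometry for the difference of two step processes. -/
theorem meanSq_integral_sub (φ ψ : StepProcess ℱ P) (hW : IsWienerProcess ℱ P W) :
    meanSq P (fun ω => φ.integral W ω - ψ.integral W ω) =
      ∫⁻ ω, meanSq volume (fun r => φ.eval r ω - ψ.eval r ω) ∂P := by
  have h := hW.meanSq_sum_increment ((Finset.range φ.steps).disjSum (Finset.range ψ.steps))
    (Sum.elim φ.coef fun j ω => -ψ.coef j ω) (Sum.elim φ.lo ψ.lo) (Sum.elim φ.hi ψ.hi)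
    (by rintro (j | j); exacts [φ.lo_le_hi j, ψ.lo_le_hi j])
    (by rintro (j | j); exacts [φ.measurable_coef j, fun h => (ψ.measurable_coef j h).neg])
    (by rintro (j | j); exacts [φ.memLp_coef j, (ψ.memLp_coef j).neg])
    (by
      rintro (j | j)
      · exact φ.memLp_term hW j
      · simp only [Sum.elim_inr, neg_mul]
        exact (ψ.memLp_term hW j).neg)
  simp only [Finset.sum_disjSum, Sum.elim_inl, Sum.elim_inr, neg_mul, Finset.sum_neg_distrib] at h
  have e : ∀ j ω, (Set.Ioc (ψ.lo j : ℝ) (ψ.hi j)).indicator (fun _ => -ψ.coef j ω) =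
      -(Set.Ioc (ψ.lo j : ℝ) (ψ.hi j)).indicator (fun _ => ψ.coef j ω) := fun j ω =>
    Set.indicator_neg' _ (fun _ => ψ.coef j ω)
  simp only [e, Pi.neg_apply, Finset.sum_neg_distrib, ← sub_eq_add_neg] at h
  exact h

end StepProcess

/-! ### Elementary processes on a time window -/

namespace ElementaryProcess

theorem memLp_coef (φ : ElementaryProcess ℱ) (j : ℕ) : MemLp (φ.coef j) 2 P := by
  obtain ⟨C, hC⟩ := φ.bounded_coef j
  exact MemLp.of_bound ((φ.measurable_coef j).mono (ℱ.le _)).aestronglyMeasurable C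
    (ae_of_all _ hC)

/-- The restriction of an elementary process to the window `(p, q]`. -/
def restrict (φ : ElementaryProcess ℱ) (P : Measure Ω) [IsProbabilityMeasure P] (p q : ℝ≥0) :
    StepProcess ℱ P where
  steps := φ.steps
  lo j := max p (min q (φ.time j))
  hi j := max p (min q (φ.time (j + 1)))
  coef := φ.coef
  lo_le_hi j := max_le_max_left _ (min_le_min_left _ (φ.monotone_time (Nat.le_succ j)))
  measurable_coef j h := by
    refine (φ.measurable_coef j).mono (ℱ.mono ?_)
    rcases le_total q (φ.time j) with h1 | h1
    · exfalso
      have h2 := φ.monotone_time (Nat.le_succ j)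
      simp [min_eq_left h1, min_eq_left (h1.trans h2)] at h
    · rw [min_eq_right h1]
      exact le_max_right _ _
  memLp_coef j := φ.memLp_coef j

theorem eval_restrict (φ : ElementaryProcess ℱ) (p q : ℝ≥0) (r : ℝ) (ω : Ω) :
    (φ.restrict P p q).eval r ω =
      (Set.Ioc (p : ℝ) q).indicator (fun r => φ.eval r.toNNReal ω) r := by
  simp only [restrict, StepProcess.eval, ElementaryProcess.eval, Set.indicator_apply]
  split_ifs with hr
  · refine Finset.sum_congr rfl fun j _ => ?_
    congr 1
    simp only [Set.mem_Ioc, Real.lt_toNNReal_iff_coe_lt, Real.toNNReal_le_iff_le_coe,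
      NNReal.coe_max, NNReal.coe_min, max_lt_iff, le_max_iff, min_lt_iff, le_min_iff, eq_iff_iff]
    obtain ⟨h1, h2⟩ := hr
    constructor
    · rintro ⟨⟨-, h3 | h3⟩, h4 | h4⟩ <;> constructor <;> linarith [h4]
    · rintro ⟨h3, h4⟩
      exact ⟨⟨h1, Or.inr h3⟩, Or.inr ⟨h2, h4⟩⟩
  · refine Finset.sum_eq_zero fun j _ => if_neg fun h => hr ?_
    simp only [Set.mem_Ioc, NNReal.coe_max,
      NNReal.coe_min, max_lt_iff, le_max_iff, le_min_iff] at h ⊢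
    exact ⟨h.1.1, h.2.elim (fun h' => absurd h' (not_le.2 h.1.1)) fun h' => h'.1⟩

theorem integral_restrict (φ : ElementaryProcess ℱ) {p q : ℝ≥0} (hpq : p ≤ q) (ω : Ω) :
    (φ.restrict P p q).integral W ω = φ.integral W q ω - φ.integral W p ω := by
  simp only [restrict, StepProcess.integral, ElementaryProcess.integral, ← Finset.sum_sub_distrib,
    ← mul_sub]
  have e : ∀ τ : ℝ≥0, W (max p (min q τ)) ω = W (min q τ) ω - W (min p τ) ω + W p ω := by
    intro τ
    rcases le_total p τ with h | h
    · rw [min_eq_left h, max_eq_right (le_min hpq h)]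
      ring
    · rw [min_eq_right h, min_eq_right (h.trans hpq), max_eq_left h]
      ring
  refine Finset.sum_congr rfl fun j _ => ?_
  rw [e, e]
  ring

theorem memLp_integral_sub (φ : ElementaryProcess ℱ) (hW : IsWienerProcess ℱ P W) {p q : ℝ≥0}
    (hpq : p ≤ q) : MemLp (fun ω => φ.integral W q ω - φ.integral W p ω) 2 P := by
  simpa only [← φ.integral_restrict (P := P) hpq] using (φ.restrict P p q).memLp_integral hW

theorem integral_zero_right (φ : ElementaryProcess ℱ) (ω : Ω) : φ.integral W 0 ω = 0 := by
  simp [ElementaryProcess.integral]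

theorem memLp_integral (φ : ElementaryProcess ℱ) (hW : IsWienerProcess ℱ P W) (t : ℝ≥0) :
    MemLp (φ.integral W t) 2 P := by
  simpa [integral_zero_right] using φ.memLp_integral_sub hW (zero_le (a := t))

theorem integral_mul_integral_sub (φ : ElementaryProcess ℱ) (hW : IsWienerProcess ℱ P W)
    {p q : ℝ≥0} (hpq : p ≤ q) {Z : Ω → ℝ} (hZ : StronglyMeasurable[ℱ p] Z) (hZ2 : MemLp Z 2 P) :
    ∫ ω, Z ω * (φ.integral W q ω - φ.integral W p ω) ∂P = 0 := by
  simp only [← φ.integral_restrict (P := P) hpq]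
  simp only [StepProcess.integral, Finset.mul_sum]
  rw [integral_finsetSum _ fun j _ =>
    integrable_mul_of_memLp_two hZ2 ((φ.restrict P p q).memLp_term hW j)]
  refine Finset.sum_eq_zero fun j _ => ?_
  set ψ := φ.restrict P p q with hψ
  rcases (ψ.lo_le_hi j).eq_or_lt with h | h
  · simp [h]
  have e : ∀ ω, Z ω * (ψ.coef j ω * (W (ψ.hi j) ω - W (ψ.lo j) ω)) =
      Z ω * ψ.coef j ω * (W (ψ.hi j) ω - W (ψ.lo j) ω) := fun ω => by ring
  have hi := integrable_mul_of_memLp_two hZ2 (ψ.memLp_term hW j)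
  simp only [e] at hi ⊢
  exact hW.integral_mul_increment h.le
    ((hZ.mono (ℱ.mono (le_max_left _ _))).mul (ψ.measurable_coef j h)) hi

theorem measurable_eval (φ : ElementaryProcess ℱ) :
    Measurable fun x : Ω × ℝ => φ.eval x.2.toNNReal x.1 := by
  unfold ElementaryProcess.eval
  refine Finset.measurable_sum _ fun j _ => ?_
  have h : MeasurableSet {x : Ω × ℝ | x.2.toNNReal ∈ Set.Ioc (φ.time j) (φ.time (j + 1))} :=
    (measurable_real_toNNReal.comp measurable_snd) measurableSet_Ioc
  have h2 : Measurable fun x : Ω × ℝ => φ.coef j x.1 :=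
    ((φ.measurable_coef j).mono (ℱ.le _)).measurable.comp measurable_fst
  exact h2.indicator h

end ElementaryProcess

end Isometry

/-! ### Mean squares over a time window -/

section Window

variable {Ω : Type*} {mΩ : MeasurableSpace Ω} {P : Measure Ω}

/-- The product of `P` with the Lebesgue measure on the time window `(p, q]`. -/
noncomputable def window (P : Measure Ω) (p q : ℝ≥0) : Measure (Ω × ℝ) :=
  P.prod (volume.restrict (Set.Ioc (p : ℝ) q))

theorem meanSq_window [SFinite P] {F : Ω × ℝ → ℝ} (hF : Measurable F) (p q : ℝ≥0) :
    meanSq (window P p q) F =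
      ∫⁻ ω, meanSq (volume.restrict (Set.Ioc (p : ℝ) q)) (fun r => F (ω, r)) ∂P :=
  lintegral_prod _ (hF.enorm.pow_const 2).aemeasurable

theorem meanSq_window_symm [SFinite P] {F : Ω × ℝ → ℝ} (hF : Measurable F) (p q : ℝ≥0) :
    meanSq (window P p q) F =
      ∫⁻ r in Set.Ioc (p : ℝ) q, meanSq P (fun ω => F (ω, r)) :=
  lintegral_prod_symm _ (hF.enorm.pow_const 2).aemeasurable

theorem meanSq_window_mono [SFinite P] {F : Ω × ℝ → ℝ} (hF : Measurable F) {p q p' q' : ℝ≥0}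
    (hp : p' ≤ p) (hq : q ≤ q') : meanSq (window P p q) F ≤ meanSq (window P p' q') F := by
  rw [meanSq_window hF, meanSq_window hF]
  exact lintegral_mono fun ω => lintegral_mono_set
    (Set.Ioc_subset_Ioc (by exact_mod_cast hp) (by exact_mod_cast hq))

theorem meanSq_window_le [SFinite P] {F : Ω × ℝ → ℝ} (hF : Measurable F) {p q : ℝ≥0} {B : ℝ≥0∞}
    (h : ∀ r : ℝ≥0, p ≤ r → r ≤ q → meanSq P (fun ω => F (ω, r)) ≤ B) :
    meanSq (window P p q) F ≤ B * ENNReal.ofReal (q - p) := by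
  rw [meanSq_window_symm hF, ← Real.volume_Ioc, ← setLIntegral_const]
  refine setLIntegral_mono measurable_const fun r hr => ?_
  have := h ⟨r, p.2.trans hr.1.le⟩ hr.1.le hr.2
  exact this

theorem meanSq_volume_indicator_sub (p q : ℝ) (f g : ℝ → ℝ) :
    meanSq volume (fun r => (Set.Ioc p q).indicator f r - (Set.Ioc p q).indicator g r) =
      meanSq (volume.restrict (Set.Ioc p q)) (fun r => f r - g r) := by
  unfold meanSq
  rw [← lintegral_indicator measurableSet_Ioc]
  congr 1 with r
  by_cases hr : r ∈ Set.Ioc p q <;> simp [hr]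

theorem enorm_intervalIntegral_sq_le {f : ℝ → ℝ} (hf : Measurable f) {p q : ℝ} (hpq : p ≤ q) :
    ‖∫ r in p..q, f r‖ₑ ^ 2 ≤
      ENNReal.ofReal (q - p) * meanSq (volume.restrict (Set.Ioc p q)) f := by
  rw [intervalIntegral.integral_of_le hpq]
  have h1 := ENNReal.lintegral_mul_le_Lp_mul_Lq (volume.restrict (Set.Ioc p q))
    Real.HolderConjugate.two_two (f := fun _ => 1) (g := fun r => ‖f r‖ₑ) aemeasurable_const
    hf.enorm.aemeasurable
  have h2 := (enorm_integral_le_lintegral_enorm (μ := volume.restrict (Set.Ioc p q)) f)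
  simp only [Pi.mul_apply, one_mul, lintegral_const, Measure.restrict_apply_univ,
    Real.volume_Ioc, ENNReal.rpow_ofNat] at h1
  calc ‖∫ r in Set.Ioc p q, f r‖ₑ ^ 2 ≤ _ := pow_le_pow_left₀ zero_le (h2.trans h1) 2
    _ = _ := by
      rw [mul_pow, ← ENNReal.rpow_mul_natCast, ← ENNReal.rpow_mul_natCast]
      norm_num [meanSq]

theorem meanSq_intervalIntegral_le [SFinite P] {F : Ω × ℝ → ℝ} (hF : Measurable F) {p q : ℝ≥0}
    (hpq : p ≤ q) : meanSq P (fun ω => ∫ r in (p : ℝ)..q, F (ω, r)) ≤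
      ENNReal.ofReal (q - p) * meanSq (window P p q) F := by
  rw [meanSq_window hF, ← lintegral_const_mul' _ _ (by simp)]
  exact lintegral_mono fun ω =>
    enorm_intervalIntegral_sq_le (hF.comp measurable_prodMk_left) (by exact_mod_cast hpq)

theorem measurable_intervalIntegral_prod {F : Ω × ℝ → ℝ} (hF : Measurable F) (p q : ℝ) :
    Measurable fun ω => ∫ r in p..q, F (ω, r) := by
  simp only [intervalIntegral]
  exact (hF.stronglyMeasurable.integral_prod_right').measurable.sub
    (hF.stronglyMeasurable.integral_prod_right').measurable

variable [IsProbabilityMeasure P] {ℱ : Filtration ℝ≥0 mΩ} {W : ℝ≥0 → Ω → ℝ}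

theorem ElementaryProcess.meanSq_integral_sub_integral (φ ψ : ElementaryProcess ℱ)
    (hW : IsWienerProcess ℱ P W) (t : ℝ≥0) :
    meanSq P (fun ω => φ.integral W t ω - ψ.integral W t ω) =
      meanSq (window P 0 t) (fun x => φ.eval x.2.toNNReal x.1 - ψ.eval x.2.toNNReal x.1) := by
  have h := (φ.restrict P 0 t).meanSq_integral_sub (ψ.restrict P 0 t) hW
  simp only [integral_restrict _ (zero_le (a := t)), integral_zero_right, sub_zero, eval_restrict,
    meanSq_volume_indicator_sub] at h
  have hm : Measurable fun x : Ω × ℝ => φ.eval x.2.toNNReal x.1 - ψ.eval x.2.toNNReal x.1 :=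
    φ.measurable_eval.sub ψ.measurable_eval
  rw [h, meanSq_window hm]

theorem ElementaryProcess.meanSq_integral_sub_increment (φ : ElementaryProcess ℱ)
    (hW : IsWienerProcess ℱ P W) {s t : ℝ≥0} (hst : s ≤ t) {Z : Ω → ℝ}
    (hZ : StronglyMeasurable[ℱ s] Z) (hZ2 : MemLp Z 2 P) :
    meanSq P (fun ω => φ.integral W t ω - φ.integral W s ω - Z ω * (W t ω - W s ω)) =
      meanSq (window P s t) (fun x => φ.eval x.2.toNNReal x.1 - Z x.1) := by
  have h := (φ.restrict P s t).meanSq_integral_sub (StepProcess.single hst hZ hZ2) hW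
  simp only [integral_restrict _ hst, StepProcess.integral_single, StepProcess.eval_single,
    eval_restrict, meanSq_volume_indicator_sub] at h
  have hm : Measurable fun x : Ω × ℝ => φ.eval x.2.toNNReal x.1 - Z x.1 :=
    φ.measurable_eval.sub ((hZ.mono (ℱ.le s)).measurable.comp measurable_fst)
  rw [h, meanSq_window hm]

end Window

/-! ### The solution and its martingale part -/

section Solution

variable {Ω : Type*} {mΩ : MeasurableSpace Ω} {P : Measure Ω}
  {ℱ : Filtration ℝ≥0 mΩ} {W X : ℝ≥0 → Ω → ℝ} {μ σ : ℝ} {T : ℝ≥0} {Y : ℝ → Ω → ℝ}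

/-- `Y` is a version of `X` on `[0, T]`, extended to real times, all of whose paths are
continuous. -/
structure IsContinuousVersion (P : Measure Ω) (T : ℝ≥0) (X : ℝ≥0 → Ω → ℝ) (Y : ℝ → Ω → ℝ) :
    Prop where
  continuous : ∀ ω, Continuous fun r => Y r ω
  measurable : ∀ r, Measurable (Y r)
  eq : ∀ᵐ ω ∂P, ∀ t ≤ T, X t ω = Y t ω

/-- The solution minus its initial value and its drift. -/
noncomputable def martingalePart (μ : ℝ) (Y : ℝ → Ω → ℝ) (t : ℝ≥0) (ω : Ω) : ℝ :=
  Y t ω - Y 0 ω - μ * ∫ r in (0 : ℝ)..t, Y r ω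

/-- Paths are set to `0` on a measurable null set that contains all discontinuous ones. The version
need not be adapted, as the filtration need not contain the null sets, but it is jointly
measurable. -/
theorem exists_isContinuousVersion (hX : ∀ t ≤ T, StronglyMeasurable[ℱ t] (X t))
    (hc : ∀ᵐ ω ∂P, ContinuousOn (fun t => X t ω) (Set.Iic T)) :
    ∃ Y : ℝ → Ω → ℝ, IsContinuousVersion P T X Y := by
  classical
  obtain ⟨N, hN, hNm, hN0⟩ := exists_measurable_superset_of_null (ae_iff.1 hc)
  have hG : ∀ ω, ω ∉ N → ContinuousOn (fun t => X t ω) (Set.Iic T) := fun ω hω => by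
    by_contra h
    exact hω (hN h)
  refine ⟨fun r ω => if ω ∈ N then 0 else X (min r.toNNReal T) ω, fun ω => ?_, fun r => ?_, ?_⟩
  · by_cases hω : ω ∈ N
    · simp [hω, continuous_const]
    · simp only [hω, if_false]
      exact (hG ω hω).comp_continuous (f := fun r : ℝ => min r.toNNReal T) (by fun_prop)
        fun r => Set.mem_Iic.2 (min_le_right _ _)
  · exact Measurable.ite hNm measurable_const
      (((hX _ (min_le_right _ _)).mono (ℱ.le _)).measurable)
  · have : ∀ᵐ ω ∂P, ω ∉ N := measure_eq_zero_iff_ae_notMem.1 hN0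
    filter_upwards [this] with ω hω t ht
    simp [hω, ht]

namespace IsContinuousVersion

theorem measurable_prod (hY : IsContinuousVersion P T X Y) :
    Measurable fun x : Ω × ℝ => Y x.2 x.1 :=
  (measurable_uncurry_of_continuous_of_measurable hY.continuous hY.measurable).comp
    measurable_swap

theorem measurable_martingalePart (hY : IsContinuousVersion P T X Y) (t : ℝ≥0) :
    Measurable (martingalePart μ Y t) :=
  ((hY.measurable t).sub (hY.measurable 0)).sub
    ((measurable_intervalIntegral_prod hY.measurable_prod 0 t).const_mul μ)

theorem martingalePart_sub (hY : IsContinuousVersion P T X Y) (s t : ℝ≥0) (ω : Ω) :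
    martingalePart μ Y t ω - martingalePart μ Y s ω =
      Y t ω - Y s ω - μ * ∫ r in (s : ℝ)..t, Y r ω := by
  have := intervalIntegral.integral_interval_sub_left
    ((hY.continuous ω).intervalIntegrable (μ := volume) 0 (t : ℝ))
    ((hY.continuous ω).intervalIntegrable 0 (s : ℝ))
  rw [← this, martingalePart, martingalePart]
  ring

theorem eq_martingalePart (hY : IsContinuousVersion P T X Y) {t : ℝ≥0} (ht : t ≤ T) {I : Ω → ℝ}
    (hI : ∀ᵐ ω ∂P, X t ω = X 0 ω + (∫ r in (0 : ℝ)..t, μ * X r.toNNReal ω) + I ω) :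
    I =ᵐ[P] martingalePart μ Y t := by
  filter_upwards [hI, hY.eq] with ω h1 h2
  have e : ∫ r in (0 : ℝ)..t, μ * X r.toNNReal ω = μ * ∫ r in (0 : ℝ)..t, Y r ω := by
    rw [← intervalIntegral.integral_const_mul]
    refine intervalIntegral.integral_congr fun r hr => ?_
    rw [Set.uIcc_of_le t.coe_nonneg] at hr
    have h3 : (r.toNNReal : ℝ) = r := Real.coe_toNNReal r hr.1
    have h4 : r.toNNReal ≤ T := (Real.toNNReal_le_iff_le_coe.2 hr.2).trans ht
    simp only [h2 _ h4, h3]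
  rw [e, h2 t ht, h2 0 zero_le] at h1
  simp only [martingalePart, NNReal.coe_zero] at h1 ⊢
  linarith

theorem lintegral_eq_meanSq_window [SFinite P] (hY : IsContinuousVersion P T X Y) (σ : ℝ) {t : ℝ≥0}
    (ht : t ≤ T) (φ : ElementaryProcess ℱ) :
    ∫⁻ ω, (∫⁻ s in Set.Icc (0 : ℝ) t,
      ‖φ.eval s.toNNReal ω - σ * X s.toNNReal ω‖ₑ ^ 2) ∂P =
    meanSq (window P 0 t) (fun x => φ.eval x.2.toNNReal x.1 - σ * Y x.2 x.1) := by
  have hm : Measurable fun x : Ω × ℝ => φ.eval x.2.toNNReal x.1 - σ * Y x.2 x.1 :=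
    φ.measurable_eval.sub (hY.measurable_prod.const_mul σ)
  rw [meanSq_window hm]
  refine lintegral_congr_ae (hY.eq.mono fun ω h2 => ?_)
  simp only [meanSq, NNReal.coe_zero]
  rw [Measure.restrict_congr_set Ioc_ae_eq_Icc]
  refine setLIntegral_congr_fun measurableSet_Icc fun r hr => ?_
  have h3 : (r.toNNReal : ℝ) = r := Real.coe_toNNReal r hr.1
  have h4 : r.toNNReal ≤ T := (Real.toNNReal_le_iff_le_coe.2 hr.2).trans ht
  simp only [h2 _ h4, h3]

end IsContinuousVersion

variable [IsProbabilityMeasure P]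

/-- One sequence of elementary processes approximates the diffusion coefficient on `[0, T]` and has
stochastic integrals converging to the martingale part at all times: the sequences that define the
Itô integrals at the various times can be exchanged for the one at time `T` by the isometry. -/
theorem IsItoSolution.exists_elementaryProcess (hW : IsWienerProcess ℱ P W)
    (hX : IsItoSolution ℱ P W (fun _ x => μ * x) (fun _ x => σ * x) T X)
    (hY : IsContinuousVersion P T X Y) :
    ∃ φ : ℕ → ElementaryProcess ℱ,
      Tendsto (fun k => meanSq (window P 0 T)
        (fun x => (φ k).eval x.2.toNNReal x.1 - σ * Y x.2 x.1)) atTop (𝓝 0) ∧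
      ∀ t ≤ T, Tendsto (fun k => meanSq P
        (fun ω => (φ k).integral W t ω - martingalePart μ Y t ω)) atTop (𝓝 0) := by
  have hex : ∀ t ≤ T, ∃ φ : ℕ → ElementaryProcess ℱ,
      Tendsto (fun k => meanSq (window P 0 t)
        (fun x => (φ k).eval x.2.toNNReal x.1 - σ * Y x.2 x.1)) atTop (𝓝 0) ∧
      Tendsto (fun k => meanSq P
        (fun ω => (φ k).integral W t ω - martingalePart μ Y t ω)) atTop (𝓝 0) := by
    intro t ht
    obtain ⟨I, ⟨-, φ, h1, h2⟩, h3⟩ := hX.integral_eq t ht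
    refine ⟨φ, ?_, ?_⟩
    · simpa only [hY.lintegral_eq_meanSq_window σ ht] using h1
    · refine h2.congr fun k => meanSq_congr (ν := P) (f := fun ω => (φ k).integral W t ω - I ω) ?_
      filter_upwards [hY.eq_martingalePart ht h3] with ω hω
      rw [hω]
  obtain ⟨φ, h1, -⟩ := hex T le_rfl
  refine ⟨φ, h1, fun t ht => ?_⟩
  obtain ⟨ψ, h2, h3⟩ := hex t ht
  have hσY : Measurable fun x : Ω × ℝ => σ * Y x.2 x.1 := hY.measurable_prod.const_mul σ
  have hφ : ∀ k, Measurable fun x : Ω × ℝ => (φ k).eval x.2.toNNReal x.1 - σ * Y x.2 x.1 :=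
    fun k => (φ k).measurable_eval.sub hσY
  have hlim := tendsto_const_mul_zero 2 (tendsto_add_zero
    (tendsto_const_mul_zero 2 (tendsto_add_zero h1 h2)) h3)
  refine tendsto_of_tendsto_of_tendsto_of_le_of_le tendsto_const_nhds hlim
    (fun k => zero_le) fun k => ?_
  simp only [ENNReal.coe_ofNat]
  have hmφ := ((φ k).memLp_integral hW t).1
  have hmψ := ((ψ k).memLp_integral hW t).1
  calc meanSq P (fun ω => (φ k).integral W t ω - martingalePart μ Y t ω)
      = meanSq P (fun ω => ((φ k).integral W t ω - (ψ k).integral W t ω) +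
          ((ψ k).integral W t ω - martingalePart μ Y t ω)) := by simp
    _ ≤ 2 * meanSq P (fun ω => (φ k).integral W t ω - (ψ k).integral W t ω) +
        2 * meanSq P (fun ω => (ψ k).integral W t ω - martingalePart μ Y t ω) :=
      meanSq_add_le (hmφ.sub hmψ)
    _ ≤ _ := by
      rw [(φ k).meanSq_integral_sub_integral (ψ k) hW t, ← mul_add]
      gcongr
      calc meanSq (window P 0 t) (fun x => (φ k).eval x.2.toNNReal x.1 -
              (ψ k).eval x.2.toNNReal x.1)
          = meanSq (window P 0 t) (fun x => ((φ k).eval x.2.toNNReal x.1 - σ * Y x.2 x.1) -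
            ((ψ k).eval x.2.toNNReal x.1 - σ * Y x.2 x.1)) := by simp
        _ ≤ _ := meanSq_sub_le (hφ k).aestronglyMeasurable
        _ ≤ _ := by
          rw [← mul_add]
          gcongr
          exact meanSq_window_mono (hφ k) le_rfl ht

/-- A stochastic integral over `[s, t]` is compared with an increment of the Wiener process with
weight known at time `s`. The factor `4` comes from using parallelogram bounds in place of the
isometry for the limits. -/
theorem IsItoSolution.meanSq_martingalePart_sub_le (hW : IsWienerProcess ℱ P W)
    (hX : IsItoSolution ℱ P W (fun _ x => μ * x) (fun _ x => σ * x) T X)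
    (hY : IsContinuousVersion P T X Y) {s t : ℝ≥0} (hst : s ≤ t) (ht : t ≤ T) {Z : Ω → ℝ}
    (hZ : StronglyMeasurable[ℱ s] Z) (hZ2 : MemLp Z 2 P) :
    meanSq P (fun ω => martingalePart μ Y t ω - martingalePart μ Y s ω -
        σ * Z ω * (W t ω - W s ω)) ≤
      4 * meanSq (window P s t) (fun x => σ * Y x.2 x.1 - σ * Z x.1) := by
  obtain ⟨φ, h1, h2⟩ := hX.exists_elementaryProcess hW hY
  have hσY : Measurable fun x : Ω × ℝ => σ * Y x.2 x.1 := hY.measurable_prod.const_mul σ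
  have hφ : ∀ k, Measurable fun x : Ω × ℝ => (φ k).eval x.2.toNNReal x.1 - σ * Y x.2 x.1 :=
    fun k => (φ k).measurable_eval.sub hσY
  have hD := fun t => (hY.measurable_martingalePart (μ := μ) t).aestronglyMeasurable (μ := P)
  have hJ := fun k t => ((φ k).memLp_integral hW t).1
  set B := meanSq (window P s t) (fun x => σ * Y x.2 x.1 - σ * Z x.1)
  set a := fun k => meanSq P (fun ω => (φ k).integral W t ω - martingalePart μ Y t ω)
  set b := fun k => meanSq P (fun ω => (φ k).integral W s ω - martingalePart μ Y s ω)
  set c := fun k => meanSq (window P 0 T)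
    (fun x => (φ k).eval x.2.toNNReal x.1 - σ * Y x.2 x.1)
  have hlim := (tendsto_const_mul_zero 4 (tendsto_add_zero (tendsto_add_zero
    (h2 t ht) (h2 s (hst.trans ht))) h1)).add_const (4 * B)
  rw [zero_add] at hlim
  refine ge_of_tendsto' hlim fun k => ?_
  simp only [ENNReal.coe_ofNat]
  have e1 : meanSq P (fun ω => (φ k).integral W t ω - (φ k).integral W s ω -
      σ * Z ω * (W t ω - W s ω)) ≤ 2 * c k + 2 * B := by
    rw [(φ k).meanSq_integral_sub_increment hW hst (hZ.const_mul σ) (hZ2.const_mul σ)]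
    calc meanSq (window P s t) (fun x => (φ k).eval x.2.toNNReal x.1 - σ * Z x.1)
        = meanSq (window P s t) (fun x => ((φ k).eval x.2.toNNReal x.1 - σ * Y x.2 x.1) +
            (σ * Y x.2 x.1 - σ * Z x.1)) := by simp
      _ ≤ _ := meanSq_add_le (hφ k).aestronglyMeasurable
      _ ≤ _ := by
        gcongr
        exact meanSq_window_mono (hφ k) zero_le ht
  have e2 : meanSq P (fun ω => ((φ k).integral W t ω - martingalePart μ Y t ω) -
      ((φ k).integral W s ω - martingalePart μ Y s ω)) ≤ 2 * a k + 2 * b k :=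
    meanSq_sub_le ((hJ k t).sub (hD t))
  have e3 : AEStronglyMeasurable (fun ω => (φ k).integral W t ω - (φ k).integral W s ω -
      σ * Z ω * (W t ω - W s ω)) P :=
    (((hJ k t).sub (hJ k s)).sub ((hZ2.1.const_mul σ).mul (hW.memLp_increment hst).1))
  calc meanSq P (fun ω => martingalePart μ Y t ω - martingalePart μ Y s ω -
        σ * Z ω * (W t ω - W s ω))
      = meanSq P (fun ω => ((φ k).integral W t ω - (φ k).integral W s ω -
          σ * Z ω * (W t ω - W s ω)) - (((φ k).integral W t ω - martingalePart μ Y t ω) -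
          ((φ k).integral W s ω - martingalePart μ Y s ω))) := by
        congr 1 with ω
        ring
    _ ≤ 2 * (2 * c k + 2 * B) + 2 * (2 * a k + 2 * b k) := by
        refine (meanSq_sub_le e3).trans ?_
        gcongr
    _ = _ := by ring

/-- Increments of the martingale part are orthogonal to the past. -/
theorem IsItoSolution.integral_mul_martingalePart_sub (hW : IsWienerProcess ℱ P W)
    (hX : IsItoSolution ℱ P W (fun _ x => μ * x) (fun _ x => σ * x) T X)
    (hY : IsContinuousVersion P T X Y) {s t : ℝ≥0} (hst : s ≤ t) (ht : t ≤ T)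
    (hD : MemLp (fun ω => martingalePart μ Y t ω - martingalePart μ Y s ω) 2 P) {Z : Ω → ℝ}
    (hZ : StronglyMeasurable[ℱ s] Z) (hZ2 : MemLp Z 2 P) :
    ∫ ω, Z ω * (martingalePart μ Y t ω - martingalePart μ Y s ω) ∂P = 0 := by
  obtain ⟨φ, -, h2⟩ := hX.exists_elementaryProcess hW hY
  refine integral_mul_eq_zero_of_tendsto hZ2 hD (fun k => (φ k).memLp_integral_sub hW hst)
    (fun k => (φ k).integral_mul_integral_sub hW hst hZ hZ2) ?_
  have hlim := tendsto_const_mul_zero 2 (tendsto_add_zero (h2 t ht) (h2 s (hst.trans ht)))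
  refine tendsto_of_tendsto_of_tendsto_of_le_of_le tendsto_const_nhds hlim
    (fun k => zero_le) fun k => ?_
  simp only [ENNReal.coe_ofNat, mul_add]
  refine le_trans (le_of_eq ?_) (meanSq_sub_le (((φ k).memLp_integral hW t).1.sub
    (hY.measurable_martingalePart (μ := μ) t).aestronglyMeasurable))
  congr 1 with ω
  ring

end Solution

/-! ### Second moments of the solution -/

section Moments

variable {Ω : Type*} {mΩ : MeasurableSpace Ω} {P : Measure Ω}
  {ℱ : Filtration ℝ≥0 mΩ} {W X : ℝ≥0 → Ω → ℝ} {μ σ : ℝ} {T : ℝ≥0} {Y : ℝ → Ω → ℝ}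

/-- Decomposition of a square integrable solution over a time step into a drift that is `μ X s`
times the length of the step up to an error of mean square `O((t - s)³)`, and an increment
orthogonal to `ℱ s` that is `σ X s (W t - W s)` up to an error of mean square `O((t - s)²)`. -/
structure HasStepExpansion (ℱ : Filtration ℝ≥0 mΩ) (P : Measure Ω) (W X : ℝ≥0 → Ω → ℝ) (μ σ : ℝ)
    (T : ℝ≥0) (C : ℝ) : Prop where
  nonneg : 0 ≤ C
  measurable : ∀ t ≤ T, StronglyMeasurable[ℱ t] (X t)
  meanSq_le : ∀ t ≤ T, meanSq P (X t) ≤ ENNReal.ofReal C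
  meanSq_sub_le : ∀ s t : ℝ≥0, s ≤ t → t ≤ T →
    meanSq P (fun ω => X t ω - X s ω) ≤ ENNReal.ofReal (C * (t - s))
  exists_eq : ∀ s t : ℝ≥0, s ≤ t → t ≤ T → ∃ A D : Ω → ℝ,
    (∀ᵐ ω ∂P, X t ω = X s ω + A ω + D ω) ∧ MemLp A 2 P ∧ MemLp D 2 P ∧
    (∀ Z : Ω → ℝ, StronglyMeasurable[ℱ s] Z → MemLp Z 2 P → ∫ ω, Z ω * D ω ∂P = 0) ∧
    meanSq P (fun ω => A ω - μ * (t - s) * X s ω) ≤ ENNReal.ofReal (C * (t - s) ^ 3) ∧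
    meanSq P (fun ω => D ω - σ * X s ω * (W t ω - W s ω)) ≤ ENNReal.ofReal (C * (t - s) ^ 2)

theorem HasStepExpansion.memLp {C : ℝ} (h : HasStepExpansion ℱ P W X μ σ T C) {t : ℝ≥0}
    (ht : t ≤ T) : MemLp (X t) 2 P :=
  (memLp_two_iff_meanSq_lt_top
    ((h.measurable t ht).mono (ℱ.le t)).aestronglyMeasurable).2
    ((h.meanSq_le t ht).trans_lt ENNReal.ofReal_lt_top)

variable [IsProbabilityMeasure P]

/-- The linear equation `y = y 0 + μ ∫ y` grows at most exponentially. -/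
theorem abs_le_of_eq_add_integral {y : ℝ → ℝ} (hy : Continuous y) {b : ℝ}
    (h : ∀ t ∈ Set.Icc 0 b, y t = y 0 + μ * ∫ r in (0 : ℝ)..t, y r) :
    ∀ t ∈ Set.Icc 0 b, |y t| ≤ Real.exp (|μ| * b) * |y 0| := by
  intro t ht
  set f : ℝ → ℝ := fun t => y 0 + μ * ∫ r in (0 : ℝ)..t, y r with hf
  have hd : ∀ x, HasDerivAt f (μ * y x) x := fun x =>
    ((hy.integral_hasStrictDerivAt 0 x).hasDerivAt.const_mul μ).const_add (y 0)
  have := norm_le_gronwallBound_of_norm_deriv_right_le (f := f) (f' := fun x => μ * y x)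
    (δ := |y 0|) (K := |μ|) (ε := 0) (a := 0) (b := b)
    (fun x _ => (hd x).continuousAt.continuousWithinAt)
    (fun x _ => (hd x).hasDerivWithinAt) (by simp [hf])
    (fun x hx => by
      rw [h x (Set.Ico_subset_Icc_self hx), norm_mul]
      simp [hf]) t ht
  rw [gronwallBound_ε0, sub_zero, Real.norm_eq_abs] at this
  rw [h t ht]
  refine this.trans ?_
  rw [mul_comm]
  gcongr
  exact ht.2

/-- Without noise the equation is solved path by path, which bounds the second moments. -/
theorem IsItoSolution.meanSq_window_lt_top_of_eq_zero (hW : IsWienerProcess ℱ P W)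
    (hX : IsItoSolution ℱ P W (fun _ x => μ * x) (fun _ x => 0 * x) T X)
    (hY : IsContinuousVersion P T X Y) (hY0 : meanSq P (Y 0) < ∞) :
    meanSq (window P 0 T) (fun x => Y x.2 x.1) < ∞ := by
  have h0 : ∀ t : ℝ≥0, t ≤ T → martingalePart μ Y t =ᵐ[P] 0 := by
    intro t ht
    have h := hX.meanSq_martingalePart_sub_le hW hY (zero_le (a := t)) ht
      (Z := fun _ => 0) stronglyMeasurable_const (memLp_const 0)
    simp only [zero_mul, sub_zero, meanSq, enorm_zero, ne_eq, OfNat.ofNat_ne_zero,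
      not_false_eq_true, zero_pow, lintegral_zero, mul_zero, nonpos_iff_eq_zero] at h
    have hm : Measurable fun ω => martingalePart μ Y t ω - martingalePart μ Y 0 ω :=
      (hY.measurable_martingalePart t).sub (hY.measurable_martingalePart 0)
    rw [lintegral_eq_zero_iff (hm.enorm.pow_const 2)] at h
    filter_upwards [h] with ω hω
    simpa [martingalePart] using hω
  -- by continuity, countably many times suffice to have the equation for all times at once
  have hrat : ∀ᵐ ω ∂P, ∀ q : ℚ, martingalePart μ Y (min (q : ℝ).toNNReal T) ω = 0 :=
    ae_all_iff.2 fun q => h0 _ (min_le_right _ _)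
  have hbound : ∀ᵐ ω ∂P, ∀ t : ℝ≥0, t ≤ T → |Y t ω| ≤ Real.exp (|μ| * T) * |Y 0 ω| := by
    filter_upwards [hrat] with ω hω t ht
    have hc : Continuous fun r : ℝ => martingalePart μ Y (min r.toNNReal T) ω := by
      have hYc := hY.continuous ω
      have hp := intervalIntegral.continuous_primitive
        (fun a b => hYc.intervalIntegrable (μ := volume) a b) 0
      have hm : Continuous fun r : ℝ => ((min r.toNNReal T : ℝ≥0) : ℝ) := by fun_prop
      exact ((hYc.comp hm).sub continuous_const).sub ((hp.comp hm).const_mul μ)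
    have hz : (fun r : ℝ => martingalePart μ Y (min r.toNNReal T) ω) = fun _ => 0 :=
      Rat.denseRange_cast.equalizer hc continuous_const (funext hω)
    refine abs_le_of_eq_add_integral (hY.continuous ω) (b := T) (fun r hr => ?_) t
      ⟨t.2, by exact_mod_cast ht⟩
    have h1 := congrFun hz r
    have h2 : r.toNNReal ≤ T := Real.toNNReal_le_iff_le_coe.2 hr.2
    simp only [min_eq_left h2, martingalePart, Real.coe_toNNReal r hr.1] at h1
    linarith
  set C := Real.exp (|μ| * T)
  refine (meanSq_window_le hY.measurable_prod
    (B := meanSq P (fun ω => C * Y 0 ω)) fun r _ hr => ?_).trans_lt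
    (ENNReal.mul_lt_top ?_ ENNReal.ofReal_lt_top)
  · refine lintegral_mono_ae (hbound.mono fun ω hω => ?_)
    rw [enorm_sq_eq_ofReal, enorm_sq_eq_ofReal]
    refine ENNReal.ofReal_le_ofReal (sq_le_sq.2 ?_)
    rw [abs_mul, abs_of_pos (Real.exp_pos _)]
    exact hω r hr
  · rw [meanSq_const_mul]
    exact ENNReal.mul_lt_top ENNReal.ofReal_lt_top hY0

/-- A solution is square integrable in time and chance. With noise this is implicit in the `L²`
definition of the Itô integral: the integrand has square integrable approximations. -/
theorem IsItoSolution.meanSq_window_lt_top (hW : IsWienerProcess ℱ P W)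
    (hX : IsItoSolution ℱ P W (fun _ x => μ * x) (fun _ x => σ * x) T X)
    (hY : IsContinuousVersion P T X Y) (hY0 : meanSq P (Y 0) < ∞) :
    meanSq (window P 0 T) (fun x => Y x.2 x.1) < ∞ := by
  rcases eq_or_ne σ 0 with rfl | hσ
  · exact hX.meanSq_window_lt_top_of_eq_zero hW hY hY0
  obtain ⟨φ, h1, -⟩ := hX.exists_elementaryProcess hW hY
  obtain ⟨k, hk⟩ := (h1.eventually_lt_const (u := 1) (by simp)).exists
  have hφ : meanSq (window P 0 T) (fun x => (φ k).eval x.2.toNNReal x.1) < ∞ := by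
    have h := (φ k).meanSq_integral_sub_increment hW (zero_le (a := T)) (Z := fun _ => 0)
      stronglyMeasurable_const (memLp_const 0)
    simp only [zero_mul, sub_zero, ElementaryProcess.integral_zero_right] at h
    rw [← h]
    exact (memLp_two_iff_meanSq_lt_top ((φ k).memLp_integral hW T).1).1
      ((φ k).memLp_integral hW T)
  have h2 : meanSq (window P 0 T) (fun x => σ * Y x.2 x.1) < ∞ := by
    have h := meanSq_sub_le (ν := window P 0 T)
      (g := fun x => (φ k).eval x.2.toNNReal x.1 - σ * Y x.2 x.1)
      (φ k).measurable_eval.aestronglyMeasurable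
    simp only [sub_sub_cancel] at h
    exact h.trans_lt (ENNReal.add_lt_top.2 ⟨ENNReal.mul_lt_top (by simp) hφ,
      ENNReal.mul_lt_top (by simp) (hk.trans (by simp))⟩)
  rw [meanSq_const_mul] at h2
  by_contra hcon
  rw [not_lt, top_le_iff] at hcon
  rw [hcon, ENNReal.mul_top (by simpa using hσ)] at h2
  exact lt_irrefl _ h2

theorem IsItoSolution.meanSq_martingalePart_sub_le_window (hW : IsWienerProcess ℱ P W)
    (hX : IsItoSolution ℱ P W (fun _ x => μ * x) (fun _ x => σ * x) T X)
    (hY : IsContinuousVersion P T X Y) {s t : ℝ≥0} (hst : s ≤ t) (ht : t ≤ T) :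
    meanSq P (fun ω => martingalePart μ Y t ω - martingalePart μ Y s ω) ≤
      ENNReal.ofReal (4 * σ ^ 2) * meanSq (window P s t) (fun x => Y x.2 x.1) := by
  have h := hX.meanSq_martingalePart_sub_le hW hY hst ht (Z := fun _ => 0)
    stronglyMeasurable_const (memLp_const 0)
  simp only [mul_zero, zero_mul, sub_zero, meanSq_const_mul] at h
  rwa [ENNReal.ofReal_mul (by norm_num), mul_assoc, ENNReal.ofReal_ofNat]

theorem IsContinuousVersion.meanSq_sub_le (hY : IsContinuousVersion P T X Y)
    (hW : IsWienerProcess ℱ P W)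
    (hX : IsItoSolution ℱ P W (fun _ x => μ * x) (fun _ x => σ * x) T X)
    {s t : ℝ≥0} (hst : s ≤ t) (ht : t ≤ T) :
    meanSq P (fun ω => Y t ω - Y s ω) ≤
      ENNReal.ofReal (2 * (μ ^ 2 * T) + 2 * (4 * σ ^ 2)) *
        meanSq (window P s t) (fun x => Y x.2 x.1) := by
  have ht' : (t : ℝ) - s ≤ T := (sub_le_self _ s.2).trans (by exact_mod_cast ht)
  have hi := (measurable_intervalIntegral_prod hY.measurable_prod s t).const_mul μ
  set B := meanSq (window P s t) (fun x => Y x.2 x.1)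
  calc meanSq P (fun ω => Y t ω - Y s ω)
      = meanSq P (fun ω => μ * (∫ r in (s : ℝ)..t, Y r ω) +
          (martingalePart μ Y t ω - martingalePart μ Y s ω)) := by
        congr 1 with ω
        rw [hY.martingalePart_sub]
        ring
    _ ≤ 2 * meanSq P (fun ω => μ * (∫ r in (s : ℝ)..t, Y r ω)) + 2 * meanSq P (fun ω =>
          martingalePart μ Y t ω - martingalePart μ Y s ω) :=
        meanSq_add_le hi.aestronglyMeasurable
    _ ≤ 2 * (ENNReal.ofReal (μ ^ 2 * T) * B) + 2 * (ENNReal.ofReal (4 * σ ^ 2) * B) := by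
        gcongr
        · rw [meanSq_const_mul, ENNReal.ofReal_mul (sq_nonneg μ), mul_assoc]
          gcongr
          refine (meanSq_intervalIntegral_le hY.measurable_prod hst).trans ?_
          gcongr
        · exact hX.meanSq_martingalePart_sub_le_window hW hY hst ht
    _ = _ := by
        rw [ENNReal.ofReal_add (by positivity) (by positivity),
          ENNReal.ofReal_mul (p := 2) (by norm_num),
          ENNReal.ofReal_mul (p := 2) (q := 4 * σ ^ 2) (by norm_num), ENNReal.ofReal_ofNat]
        ring

/-- Square integrability over time and chance bounds the second moments uniformly, this bounds the
mean-square increments linearly in time, and then the isometry and the Cauchy-Schwarz inequality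
give the two error terms of the expansion. -/
theorem IsItoSolution.exists_hasStepExpansion (hW : IsWienerProcess ℱ P W)
    (hX : IsItoSolution ℱ P W (fun _ x => μ * x) (fun _ x => σ * x) T X)
    (hX₀ : MemLp (X 0) 2 P) : ∃ C, HasStepExpansion ℱ P W X μ σ T C := by
  obtain ⟨Y, hY⟩ := exists_isContinuousVersion hX.adapted hX.continuous
  have hXY : ∀ t : ℝ≥0, t ≤ T → X t =ᵐ[P] Y t := fun t ht => hY.eq.mono fun ω h => h t ht
  have hY0 : meanSq P (Y 0) < ∞ := by
    have h : X 0 =ᵐ[P] Y 0 := by simpa using hXY 0 zero_le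
    rw [← meanSq_congr h]
    exact (memLp_two_iff_meanSq_lt_top hX₀.1).1 hX₀
  have hfin := hX.meanSq_window_lt_top hW hY hY0
  set L : ℝ := 2 * (μ ^ 2 * T) + 2 * (4 * σ ^ 2) with hL
  have hL0 : 0 ≤ L := by positivity
  set F : Ω × ℝ → ℝ := fun x => Y x.2 x.1
  have hF : Measurable F := hY.measurable_prod
  -- a bound for the second moments
  obtain ⟨K, hK0, hK⟩ : ∃ K : ℝ, 0 ≤ K ∧ ∀ t : ℝ≥0, t ≤ T →
      meanSq P (Y t) ≤ ENNReal.ofReal K := by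
    set B := 2 * (ENNReal.ofReal L * meanSq (window P 0 T) F) + 2 * meanSq P (Y 0) with hB
    have hBt : B < ∞ := ENNReal.add_lt_top.2 ⟨ENNReal.mul_lt_top (by simp)
      (ENNReal.mul_lt_top (by simp) hfin), ENNReal.mul_lt_top (by simp) hY0⟩
    refine ⟨B.toReal, ENNReal.toReal_nonneg, fun t ht => ?_⟩
    rw [ENNReal.ofReal_toReal hBt.ne]
    have h1 := meanSq_add_le (ν := P) (f := fun ω => Y t ω - Y 0 ω) (g := Y 0)
      ((hY.measurable t).sub (hY.measurable 0)).aestronglyMeasurable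
    simp only [sub_add_cancel] at h1
    refine h1.trans ?_
    rw [hB]
    gcongr
    have h2 := hY.meanSq_sub_le hW hX (zero_le (a := t)) ht
    simp only [NNReal.coe_zero] at h2
    refine h2.trans ?_
    gcongr
    exact meanSq_window_mono hF le_rfl ht
  -- mean square Hölder continuity
  have hH : ∀ s t : ℝ≥0, s ≤ t → t ≤ T →
      meanSq P (fun ω => Y t ω - Y s ω) ≤ ENNReal.ofReal (L * K * (t - s)) := by
    intro s t hst ht
    refine (hY.meanSq_sub_le hW hX hst ht).trans ?_
    rw [ENNReal.ofReal_mul (by positivity), ENNReal.ofReal_mul hL0, mul_assoc]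
    gcongr
    exact meanSq_window_le hF fun r _ hr => hK r (hr.trans ht)
  have hwin : ∀ s t : ℝ≥0, s ≤ t → t ≤ T →
      meanSq (window P s t) (fun x => Y x.2 x.1 - Y s x.1) ≤
        ENNReal.ofReal (L * K * (t - s) ^ 2) := by
    intro s t hst ht
    have hst' : (0 : ℝ) ≤ t - s := sub_nonneg.2 (by exact_mod_cast hst)
    have hm : Measurable fun x : Ω × ℝ => Y x.2 x.1 - Y s x.1 :=
      hF.sub ((hY.measurable s).comp measurable_fst)
    refine (meanSq_window_le hm (B := ENNReal.ofReal (L * K * (t - s))) fun r hr hrt => ?_).trans ?_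
    · refine (hH s r hr (hrt.trans ht)).trans ?_
      gcongr
    · rw [← ENNReal.ofReal_mul (by positivity)]
      apply le_of_eq
      congr 1
      ring
  have hmem : ∀ s t : ℝ≥0, s ≤ t → t ≤ T →
      MemLp (fun ω => martingalePart μ Y t ω - martingalePart μ Y s ω) 2 P := by
    intro s t hst ht
    have hm : Measurable fun ω => martingalePart μ Y t ω - martingalePart μ Y s ω :=
      (hY.measurable_martingalePart t).sub (hY.measurable_martingalePart s)
    rw [memLp_two_iff_meanSq_lt_top hm.aestronglyMeasurable]
    exact (hX.meanSq_martingalePart_sub_le_window hW hY hst ht).trans_lt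
      (ENNReal.mul_lt_top ENNReal.ofReal_lt_top ((meanSq_window_mono hF zero_le ht).trans_lt hfin))
  set C : ℝ := K + L * K * (1 + μ ^ 2 + 4 * σ ^ 2)
  have hLK : 0 ≤ L * K := by positivity
  have hC1 : K ≤ C := le_add_of_nonneg_right (by positivity)
  have hC2 : L * K ≤ C := by nlinarith [mul_nonneg hLK (sq_nonneg μ), mul_nonneg hLK (sq_nonneg σ)]
  have hC3 : μ ^ 2 * (L * K) ≤ C := by
    nlinarith [mul_nonneg hLK (sq_nonneg μ), mul_nonneg hLK (sq_nonneg σ)]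
  have hC4 : 4 * σ ^ 2 * (L * K) ≤ C := by
    nlinarith [mul_nonneg hLK (sq_nonneg μ), mul_nonneg hLK (sq_nonneg σ)]
  refine ⟨C, hK0.trans hC1, hX.adapted, fun t ht => ?_, fun s t hst ht => ?_,
    fun s t hst ht => ?_⟩
  · rw [meanSq_congr (hXY t ht)]
    exact (hK t ht).trans (by gcongr)
  · have hst' : (0 : ℝ) ≤ t - s := sub_nonneg.2 (by exact_mod_cast hst)
    have e : (fun ω => X t ω - X s ω) =ᵐ[P] fun ω => Y t ω - Y s ω :=
      (hXY t ht).sub (hXY s (hst.trans ht))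
    rw [meanSq_congr e]
    exact (hH s t hst ht).trans (by gcongr)
  · have hst' : (0 : ℝ) ≤ t - s := sub_nonneg.2 (by exact_mod_cast hst)
    have hsT := hst.trans ht
    have hXm := hX.adapted s hsT
    have hX2 : MemLp (X s) 2 P := by
      rw [memLp_two_iff_meanSq_lt_top (hXm.mono (ℱ.le s)).aestronglyMeasurable,
        meanSq_congr (hXY s hsT)]
      exact (hK s hsT).trans_lt ENNReal.ofReal_lt_top
    have hi := measurable_intervalIntegral_prod hF s t
    refine ⟨fun ω => μ * ∫ r in (s : ℝ)..t, Y r ω,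
      fun ω => martingalePart μ Y t ω - martingalePart μ Y s ω, ?_, ?_, hmem s t hst ht,
      fun Z hZ hZ2 => hX.integral_mul_martingalePart_sub hW hY hst ht (hmem s t hst ht) hZ hZ2,
      ?_, ?_⟩
    · filter_upwards [hXY t ht, hXY s hsT] with ω h1 h2
      rw [h1, h2, hY.martingalePart_sub]
      ring
    · refine MemLp.const_mul ?_ μ
      rw [memLp_two_iff_meanSq_lt_top hi.aestronglyMeasurable]
      exact (meanSq_intervalIntegral_le hF hst).trans_lt (ENNReal.mul_lt_top (by simp)
        ((meanSq_window_mono hF zero_le ht).trans_lt hfin))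
    · have hm : Measurable fun x : Ω × ℝ => Y x.2 x.1 - Y s x.1 :=
        hF.sub ((hY.measurable s).comp measurable_fst)
      have e : (fun ω => μ * (∫ r in (s : ℝ)..t, Y r ω) - μ * (t - s) * X s ω) =ᵐ[P]
          fun ω => μ * ∫ r in (s : ℝ)..t, (Y r ω - Y s ω) := by
        filter_upwards [hXY s hsT] with ω h2
        rw [h2, intervalIntegral.integral_sub ((hY.continuous ω).intervalIntegrable _ _) (by simp),
          intervalIntegral.integral_const, smul_eq_mul]
        ring
      rw [meanSq_congr e, meanSq_const_mul]
      calc _ ≤ ENNReal.ofReal (μ ^ 2) * (ENNReal.ofReal (t - s) *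
            ENNReal.ofReal (L * K * (t - s) ^ 2)) := by
            gcongr
            exact (meanSq_intervalIntegral_le hm hst).trans (by gcongr; exact hwin s t hst ht)
        _ = ENNReal.ofReal (μ ^ 2 * (L * K) * (t - s) ^ 3) := by
            rw [← ENNReal.ofReal_mul hst', ← ENNReal.ofReal_mul (sq_nonneg μ)]
            congr 1
            ring
        _ ≤ _ := by gcongr
    · refine (hX.meanSq_martingalePart_sub_le hW hY hst ht hXm hX2).trans ?_
      have e : meanSq (window P s t) (fun x => σ * Y x.2 x.1 - σ * X s x.1) =
          ENNReal.ofReal (σ ^ 2) * meanSq (window P s t) (fun x => Y x.2 x.1 - Y s x.1) := by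
        rw [← meanSq_const_mul]
        refine meanSq_congr ?_
        have h := (Measure.quasiMeasurePreserving_fst (μ := P)
          (ν := volume.restrict (Set.Ioc (s : ℝ) t))).ae (hXY s hsT)
        refine h.mono fun x hx => ?_
        simp only [hx]
        ring
      rw [e]
      calc _ ≤ 4 * (ENNReal.ofReal (σ ^ 2) * ENNReal.ofReal (L * K * (t - s) ^ 2)) := by
            gcongr
            exact hwin s t hst ht
        _ = ENNReal.ofReal (4 * σ ^ 2 * (L * K) * (t - s) ^ 2) := by
            rw [← ENNReal.ofReal_ofNat 4, ← ENNReal.ofReal_mul (sq_nonneg σ),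
              ← ENNReal.ofReal_mul (by norm_num)]
            congr 1
            ring
        _ ≤ _ := by gcongr

end Moments

/-! ### One step of a scheme that is affine in the noise -/

section Step

variable {Ω : Type*} {mΩ : MeasurableSpace Ω} {P : Measure Ω}
  {ℱ : Filtration ℝ≥0 mΩ} {W X : ℝ≥0 → Ω → ℝ} {μ σ : ℝ} {T : ℝ≥0}

theorem meanSq_add_le_ofReal {f g : Ω → ℝ} (hf : AEStronglyMeasurable f P) {x y : ℝ} (hx : 0 ≤ x)
    (hy : 0 ≤ y) (hfx : meanSq P f ≤ ENNReal.ofReal x) (hgy : meanSq P g ≤ ENNReal.ofReal y) :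
    meanSq P (fun ω => f ω + g ω) ≤ ENNReal.ofReal (2 * x + 2 * y) := by
  rw [ENNReal.ofReal_add (by positivity) (by positivity), ENNReal.ofReal_mul (p := 2) (by norm_num),
    ENNReal.ofReal_mul (p := 2) (by norm_num), ENNReal.ofReal_ofNat]
  exact (meanSq_add_le hf).trans (by gcongr)

theorem meanSq_const_mul_le_ofReal {f : Ω → ℝ} (c : ℝ) {x : ℝ}
    (hfx : meanSq P f ≤ ENNReal.ofReal x) :
    meanSq P (fun ω => c * f ω) ≤ ENNReal.ofReal (c ^ 2 * x) := by
  rw [meanSq_const_mul, ENNReal.ofReal_mul (sq_nonneg c)]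
  gcongr

/-- A linear combination of the increments of `W` over `[s, u]` and over `[s, t]`. -/
def stepNoise (W : ℝ≥0 → Ω → ℝ) (s u t : ℝ≥0) (b c : ℝ) (ω : Ω) : ℝ :=
  b * (W u ω - W s ω) + c * (W t ω - W s ω)

theorem stepNoise_mul (s u t : ℝ≥0) (b c : ℝ) (Z : Ω → ℝ) (ω : Ω) :
    stepNoise W s u t b c ω * Z ω =
      b * (Z ω * (W u ω - W s ω)) + c * (Z ω * (W t ω - W s ω)) := by
  rw [stepNoise]
  ring

variable [IsProbabilityMeasure P]

theorem IsWienerProcess.memLp_stepNoise_mul (hW : IsWienerProcess ℱ P W) {s u t : ℝ≥0}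
    (hsu : s ≤ u) (hut : u ≤ t) (b c : ℝ) {Z : Ω → ℝ} (hZ : StronglyMeasurable[ℱ s] Z)
    (hZ2 : MemLp Z 2 P) : MemLp (fun ω => stepNoise W s u t b c ω * Z ω) 2 P := by
  simp only [stepNoise_mul]
  exact ((hW.memLp_mul_increment hsu hZ hZ2).const_mul b).add
    ((hW.memLp_mul_increment (hsu.trans hut) hZ hZ2).const_mul c)

theorem IsWienerProcess.integral_mul_stepNoise_mul (hW : IsWienerProcess ℱ P W) {s u t : ℝ≥0}
    (hsu : s ≤ u) (hut : u ≤ t) (b c : ℝ) {Z Z' : Ω → ℝ} (hZ : StronglyMeasurable[ℱ s] Z)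
    (hZ2 : MemLp Z 2 P) (hZ' : StronglyMeasurable[ℱ s] Z') (hZ'2 : MemLp Z' 2 P) :
    ∫ ω, Z' ω * (stepNoise W s u t b c ω * Z ω) ∂P = 0 := by
  have key : ∀ v, s ≤ v → Integrable (fun ω => Z' ω * (Z ω * (W v ω - W s ω))) P ∧
      ∫ ω, Z' ω * (Z ω * (W v ω - W s ω)) ∂P = 0 := by
    intro v hv
    have hi := integrable_mul_of_memLp_two hZ'2 (hW.memLp_mul_increment hv hZ hZ2)
    refine ⟨hi, ?_⟩
    simp only [← mul_assoc] at hi ⊢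
    exact hW.integral_mul_increment hv (hZ'.mul hZ) hi
  have e : ∀ ω, Z' ω * (stepNoise W s u t b c ω * Z ω) =
      b * (Z' ω * (Z ω * (W u ω - W s ω))) + c * (Z' ω * (Z ω * (W t ω - W s ω))) := fun ω => by
    rw [stepNoise]
    ring
  simp only [e]
  rw [integral_add ((key u hsu).1.const_mul b) ((key t (hsu.trans hut)).1.const_mul c),
    integral_const_mul, integral_const_mul, (key u hsu).2, (key t (hsu.trans hut)).2]
  simp

theorem IsWienerProcess.meanSq_stepNoise_mul_le (hW : IsWienerProcess ℱ P W) {s u t : ℝ≥0}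
    (hsu : s ≤ u) (hut : u ≤ t) (b c : ℝ) {Z : Ω → ℝ} (hZ : StronglyMeasurable[ℱ s] Z)
    {x : ℝ} (hx : 0 ≤ x) (hZx : meanSq P Z ≤ ENNReal.ofReal x) :
    meanSq P (fun ω => stepNoise W s u t b c ω * Z ω) ≤
      ENNReal.ofReal (2 * (b ^ 2 + c ^ 2) * (t - s) * x) := by
  have hst' : (0 : ℝ) ≤ t - s := sub_nonneg.2 (by exact_mod_cast hsu.trans hut)
  have hZ2 : MemLp Z 2 P := (memLp_two_iff_meanSq_lt_top (hZ.mono (ℱ.le s)).aestronglyMeasurable).2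
    (hZx.trans_lt ENNReal.ofReal_lt_top)
  have key : ∀ v, s ≤ v → v ≤ t →
      meanSq P (fun ω => Z ω * (W v ω - W s ω)) ≤ ENNReal.ofReal ((t - s) * x) := by
    intro v hv hvt
    rw [hW.meanSq_mul_increment hv hZ, ENNReal.ofReal_mul hst']
    gcongr
  simp only [stepNoise_mul]
  refine (meanSq_add_le_ofReal ((hW.memLp_mul_increment hsu hZ hZ2).const_mul b).1
    (by positivity) (by positivity) (meanSq_const_mul_le_ofReal b (key u hsu hut))
    (meanSq_const_mul_le_ofReal c (key t (hsu.trans hut) le_rfl))).trans_eq ?_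
  congr 1
  ring

/-- One step of the scheme `Z ↦ (a + b (W u - W s) + c (W t - W s)) Z`. The error splits into `a`
times the old error, a part orthogonal to `ℱ s`, and a remainder; the first two are orthogonal, and
only the remainder is paid for with the weights `1 + (t - s)` and `1 + 1 / (t - s)`. -/
theorem HasStepExpansion.meanSq_step_le {C : ℝ} (h : HasStepExpansion ℱ P W X μ σ T C)
    (hW : IsWienerProcess ℱ P W) {s u t : ℝ≥0} (hsu : s ≤ u) (hut : u ≤ t) (htT : t ≤ T)
    (hst : s < t) (a b c : ℝ) {Z : Ω → ℝ} (hZ : StronglyMeasurable[ℱ s] Z) (hZ2 : MemLp Z 2 P)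
    {x : ℝ} (hx : 0 ≤ x) (hZx : meanSq P (fun ω => X s ω - Z ω) ≤ ENNReal.ofReal x) :
    meanSq P (fun ω => X t ω - (a * Z ω + stepNoise W s u t b c ω * Z ω)) ≤
      ENNReal.ofReal ((1 + (t - s)) * (a ^ 2 * x + (2 * (C * (t - s) ^ 2) +
        2 * (2 * (2 * (b ^ 2 + (σ - c) ^ 2) * (t - s) * C) +
          2 * (2 * (b ^ 2 + c ^ 2) * (t - s) * x)))) +
        (1 + 1 / (t - s)) * (2 * (C * (t - s) ^ 3) + 2 * ((μ * (t - s) + 1 - a) ^ 2 * C))) := by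
  have hC := h.nonneg
  have hst' : (0 : ℝ) < t - s := sub_pos.2 (by exact_mod_cast hst)
  have hsT := hst.le.trans htT
  have hXm := h.measurable s hsT
  have hX2 : MemLp (X s) 2 P := h.memLp hsT
  have hem : StronglyMeasurable[ℱ s] fun ω => X s ω - Z ω := hXm.sub hZ
  have he2 : MemLp (fun ω => X s ω - Z ω) 2 P := hX2.sub hZ2
  obtain ⟨A, D, heq, hA2, hD2, hD0, hA, hD⟩ := h.exists_eq s t hst.le htT
  -- the remainder
  have hR : meanSq P (fun ω => (A ω - μ * (t - s) * X s ω) + (μ * (t - s) + 1 - a) * X s ω) ≤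
      ENNReal.ofReal (2 * (C * (t - s) ^ 3) + 2 * ((μ * (t - s) + 1 - a) ^ 2 * C)) :=
    meanSq_add_le_ofReal (hA2.sub (hX2.const_mul _)).1 (by positivity) (by positivity) hA
      (meanSq_const_mul_le_ofReal _ (h.meanSq_le s hsT))
  -- the part orthogonal to the past
  have hN2 := hW.memLp_stepNoise_mul hsu hut b c hZ hZ2
  have hM2 : MemLp (fun ω => D ω - stepNoise W s u t b c ω * Z ω) 2 P := hD2.sub hN2
  have hM : meanSq P (fun ω => D ω - stepNoise W s u t b c ω * Z ω) ≤
      ENNReal.ofReal (2 * (C * (t - s) ^ 2) +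
        2 * (2 * (2 * (b ^ 2 + (σ - c) ^ 2) * (t - s) * C) +
          2 * (2 * (b ^ 2 + c ^ 2) * (t - s) * x))) := by
    have h1 := hW.meanSq_stepNoise_mul_le hsu hut (-b) (σ - c) hXm hC (h.meanSq_le s hsT)
    have h2 := hW.meanSq_stepNoise_mul_le hsu hut b c hem hx hZx
    rw [neg_sq] at h1
    have h3 := meanSq_add_le_ofReal (hW.memLp_stepNoise_mul hsu hut (-b) (σ - c) hXm hX2).1
      (by positivity) (by positivity) h1 h2
    have h4 := meanSq_add_le_ofReal (f := fun ω => D ω - σ * X s ω * (W t ω - W s ω))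
      (hD2.1.sub ((hX2.1.const_mul σ).mul (hW.memLp_increment hst.le).1))
      (by positivity) (by positivity) hD h3
    refine le_trans (le_of_eq ?_) h4
    congr 1 with ω
    simp only [stepNoise]
    ring
  have horth : ∫ ω, a * (X s ω - Z ω) * (D ω - stepNoise W s u t b c ω * Z ω) ∂P = 0 := by
    have h1 := hD0 _ (hem.const_mul a) (he2.const_mul a)
    have h2 := hW.integral_mul_stepNoise_mul hsu hut b c hZ hZ2 (hem.const_mul a)
      (he2.const_mul a)
    simp only [mul_sub (_ * _)] at h1 h2 ⊢
    rw [integral_sub (integrable_mul_of_memLp_two (he2.const_mul a) hD2)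
      (integrable_mul_of_memLp_two (he2.const_mul a) hN2), h1, h2, sub_zero]
  have hmain := meanSq_add_of_orthogonal (he2.const_mul a) hM2 horth
  have hsplit : (fun ω => X t ω - (a * Z ω + stepNoise W s u t b c ω * Z ω)) =ᵐ[P]
      fun ω => (a * (X s ω - Z ω) + (D ω - stepNoise W s u t b c ω * Z ω)) +
        ((A ω - μ * (t - s) * X s ω) + (μ * (t - s) + 1 - a) * X s ω) := by
    filter_upwards [heq] with ω hω
    rw [hω]
    ring
  rw [meanSq_congr hsplit]
  -- no constant greater than `1` may be lost on `a` times the old error, hence Pythagoras here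
  have hS : meanSq P (fun ω => a * (X s ω - Z ω) + (D ω - stepNoise W s u t b c ω * Z ω)) ≤
      ENNReal.ofReal (a ^ 2 * x + (2 * (C * (t - s) ^ 2) +
        2 * (2 * (2 * (b ^ 2 + (σ - c) ^ 2) * (t - s) * C) +
          2 * (2 * (b ^ 2 + c ^ 2) * (t - s) * x)))) := by
    rw [hmain, ENNReal.ofReal_add (by positivity) (by positivity)]
    exact add_le_add (meanSq_const_mul_le_ofReal a hZx) hM
  refine (meanSq_add_le_weighted
    (f := fun ω => a * (X s ω - Z ω) + (D ω - stepNoise W s u t b c ω * Z ω))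
    ((he2.const_mul a).add hM2).1 hst').trans ?_
  refine (add_le_add (mul_le_mul_right hS _) (mul_le_mul_right hR _)).trans_eq ?_
  rw [← ENNReal.ofReal_mul (by positivity), ← ENNReal.ofReal_mul (by positivity),
    ← ENNReal.ofReal_add (by positivity) (by positivity)]

/-- The error at an intermediate time `u`. Parallelogram bounds suffice here: the scheme does not
continue from this value, so the constants are not multiplied over the steps. -/
theorem HasStepExpansion.meanSq_intermediate_le {C : ℝ} (h : HasStepExpansion ℱ P W X μ σ T C)
    (hW : IsWienerProcess ℱ P W) {s u t : ℝ≥0} (hsu : s ≤ u) (hut : u ≤ t) (htT : t ≤ T)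
    (a b c : ℝ) {Z : Ω → ℝ} (hZ : StronglyMeasurable[ℱ s] Z) (hZ2 : MemLp Z 2 P)
    {x : ℝ} (hx : 0 ≤ x) (hZx : meanSq P (fun ω => X s ω - Z ω) ≤ ENNReal.ofReal x) :
    meanSq P (fun ω => X u ω - (a * Z ω + stepNoise W s u t b c ω * Z ω)) ≤
      ENNReal.ofReal (2 * (2 * (C * (t - s)) + 2 * ((1 - a) ^ 2 * C)) +
        2 * (2 * (a ^ 2 * x) + 2 * (2 * (b ^ 2 + c ^ 2) * (t - s) * (2 * C + 2 * x)))) := by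
  have hC := h.nonneg
  have huT := hut.trans htT
  have hsT := hsu.trans huT
  have hst' : (0 : ℝ) ≤ t - s := sub_nonneg.2 (by exact_mod_cast hsu.trans hut)
  have hX2 : MemLp (X s) 2 P := h.memLp hsT
  have he2 : MemLp (fun ω => X s ω - Z ω) 2 P := hX2.sub hZ2
  have hXu : MemLp (fun ω => X u ω - X s ω) 2 P := (h.memLp huT).sub hX2
  have h0 : meanSq P (fun ω => X u ω - X s ω) ≤ ENNReal.ofReal (C * (t - s)) :=
    (h.meanSq_sub_le s u hsu huT).trans (by gcongr)
  have hZ' : meanSq P Z ≤ ENNReal.ofReal (2 * C + 2 * x) := by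
    have h1 := meanSq_add_le_ofReal (g := fun ω => -1 * (X s ω - Z ω)) hX2.1 hC (by positivity)
      (h.meanSq_le s hsT) (meanSq_const_mul_le_ofReal (-1) hZx)
    simpa using h1
  have h1 := meanSq_add_le_ofReal hXu.1 (by positivity) (by positivity) h0
    (meanSq_const_mul_le_ofReal (1 - a) (h.meanSq_le s hsT))
  have h2 := hW.meanSq_stepNoise_mul_le hsu hut (-b) (-c) hZ (by positivity) hZ'
  rw [neg_sq, neg_sq] at h2
  have h3 := meanSq_add_le_ofReal (he2.const_mul a).1 (by positivity) (by positivity)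
    (meanSq_const_mul_le_ofReal a hZx) h2
  have h4 := meanSq_add_le_ofReal (hXu.add (hX2.const_mul (1 - a))).1 (by positivity)
    (by positivity) h1 h3
  refine le_trans (le_of_eq ?_) h4
  congr 1 with ω
  simp only [stepNoise, Pi.add_apply]
  ring

end Step

/-! ### The coefficients of the scheme -/

section Coefficients

/-- The common denominator of the factors `α n`. It is positive for all step sizes. -/
noncomputable def oddDenom (μ d : ℝ) : ℝ := 1 - μ * d + (μ * d) ^ 2 / 3

/-- The part of `α n` that does not involve the noise. -/
noncomputable def oddDrift (μ d : ℝ) : ℝ := (1 - (μ * d) ^ 2 / 6) / oddDenom μ d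

/-- The coefficient in `α n` of the increment of `W` over one grid cell. -/
noncomputable def oddMid (μ σ d : ℝ) : ℝ := σ * (1 - μ * d / 3) / oddDenom μ d

/-- The coefficient in `α n` of the increment of `W` over two grid cells. -/
noncomputable def oddEnd (μ σ d : ℝ) : ℝ := -(σ * (μ * d / 12)) / oddDenom μ d

/-- The part of `β n` that does not involve the noise. -/
noncomputable def evenDrift (μ d : ℝ) : ℝ :=
  (1 + μ * d / 3 + 4 * (μ * d) / 3 * oddDrift μ d) / (1 - μ * d / 3)

/-- The coefficient in `β n` of the increment of `W` over one grid cell. -/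
noncomputable def evenMid (μ σ d : ℝ) : ℝ := 4 * (μ * d) / 3 * oddMid μ σ d / (1 - μ * d / 3)

/-- The coefficient in `β n` of the increment of `W` over two grid cells. -/
noncomputable def evenEnd (μ σ d : ℝ) : ℝ :=
  (4 * (μ * d) / 3 * oddEnd μ σ d + σ) / (1 - μ * d / 3)

/-- The quotient `(1 + 2 μ d - evenDrift μ d) / d²`, as a function continuous at `d = 0`. -/
noncomputable def driftDefect (μ d : ℝ) : ℝ :=
  μ ^ 2 * (4 / 3 * (-(3 / 2) + μ * d - (μ * d) ^ 2 / 6)) / (oddDenom μ d * (1 - μ * d / 3))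

theorem oddDenom_pos (μ d : ℝ) : 0 < oddDenom μ d := by
  unfold oddDenom
  nlinarith [sq_nonneg (μ * d - 3 / 2)]

/-- The drift of a double step is consistent with the equation to second order. -/
theorem one_add_sub_evenDrift {μ d : ℝ} (hd : 1 - μ * d / 3 ≠ 0) :
    μ * (2 * d) + 1 - evenDrift μ d = d ^ 2 * driftDefect μ d := by
  have h := (oddDenom_pos μ d).ne'
  unfold evenDrift driftDefect oddDrift
  obtain ⟨q, hq⟩ : ∃ q, q = 1 - μ * d / 3 := ⟨_, rfl⟩
  rw [← hq] at hd ⊢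
  field_simp
  rw [hq]
  unfold oddDenom
  ring

theorem continuousAt_oddDenom (μ : ℝ) : ContinuousAt (oddDenom μ) 0 := by
  unfold oddDenom
  fun_prop

theorem continuousAt_oddDrift (μ : ℝ) : ContinuousAt (oddDrift μ) 0 :=
  ContinuousAt.div (by fun_prop) (continuousAt_oddDenom μ) (oddDenom_pos μ 0).ne'

theorem continuousAt_oddMid (μ σ : ℝ) : ContinuousAt (oddMid μ σ) 0 :=
  ContinuousAt.div (by fun_prop) (continuousAt_oddDenom μ) (oddDenom_pos μ 0).ne'

theorem continuousAt_oddEnd (μ σ : ℝ) : ContinuousAt (oddEnd μ σ) 0 :=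
  ContinuousAt.div (by fun_prop) (continuousAt_oddDenom μ) (oddDenom_pos μ 0).ne'

theorem continuousAt_evenMid (μ σ : ℝ) : ContinuousAt (evenMid μ σ) 0 := by
  have := continuousAt_oddMid μ σ
  exact ContinuousAt.div (by fun_prop) (by fun_prop) (by norm_num)

theorem continuousAt_evenEnd (μ σ : ℝ) : ContinuousAt (evenEnd μ σ) 0 := by
  have := continuousAt_oddEnd μ σ
  exact ContinuousAt.div (by fun_prop) (by fun_prop) (by norm_num)

theorem continuousAt_driftDefect (μ : ℝ) : ContinuousAt (driftDefect μ) 0 := by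
  have := continuousAt_oddDenom μ
  exact ContinuousAt.div (by fun_prop) (by fun_prop) (by simp [(oddDenom_pos μ 0).ne'])

/-- The relative growth of the bound for the mean-square error over a double step: the bound is
multiplied by `1 + 2 d * growthRate μ σ d`. -/
noncomputable def growthRate (μ σ d : ℝ) : ℝ :=
  1 + (1 + 2 * d) * (2 * (μ - d / 2 * driftDefect μ d) +
    2 * d * (μ - d / 2 * driftDefect μ d) ^ 2 + 8 * (evenMid μ σ d ^ 2 + evenEnd μ σ d ^ 2))

/-- A double step adds `2 d * defectRate μ σ C d` to the bound for the mean-square error. The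
factor `2 d` has been split off, so that convergence amounts to `defectRate μ σ C d → 0`. -/
noncomputable def defectRate (μ σ C d : ℝ) : ℝ :=
  (1 + 2 * d) * (8 * C * d + 8 * (evenMid μ σ d ^ 2 + (σ - evenEnd μ σ d) ^ 2) * C +
    d ^ 2 * driftDefect μ d ^ 2 / 2 * C)

theorem continuousAt_growthRate (μ σ : ℝ) : ContinuousAt (growthRate μ σ) 0 := by
  have := continuousAt_evenMid μ σ
  have := continuousAt_evenEnd μ σ
  have := continuousAt_driftDefect μ
  unfold growthRate
  fun_prop

/-- The defect vanishes in the limit because the noise coefficients of `β n` tend to `0` and `σ`,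
and because `d⁻² (1 + 2 μ d - evenDrift μ d)` stays bounded. -/
theorem tendsto_defectRate (μ σ C : ℝ) : Tendsto (defectRate μ σ C) (𝓝 0) (𝓝 0) := by
  have := continuousAt_evenMid μ σ
  have := continuousAt_evenEnd μ σ
  have := continuousAt_driftDefect μ
  have h : ContinuousAt (defectRate μ σ C) 0 := by
    unfold defectRate
    fun_prop
  have h0 : defectRate μ σ C 0 = 0 := by
    simp [defectRate, evenMid, evenEnd]
  simpa [h0] using h.tendsto

theorem defectRate_nonneg (μ σ : ℝ) {C d : ℝ} (hC : 0 ≤ C) (hd : 0 ≤ d) :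
    0 ≤ defectRate μ σ C d := by
  unfold defectRate
  positivity

/-- The bound of `HasStepExpansion.meanSq_step_le` for a double step, of length `2 d`, in terms of
the two rates. -/
theorem stepBound_eq {μ d : ℝ} (σ C x : ℝ) (hd0 : d ≠ 0) (hd : 1 - μ * d / 3 ≠ 0) :
    (1 + 2 * d) * (evenDrift μ d ^ 2 * x + (2 * (C * (2 * d) ^ 2) +
        2 * (2 * (2 * (evenMid μ σ d ^ 2 + (σ - evenEnd μ σ d) ^ 2) * (2 * d) * C) +
          2 * (2 * (evenMid μ σ d ^ 2 + evenEnd μ σ d ^ 2) * (2 * d) * x)))) +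
        (1 + 1 / (2 * d)) * (2 * (C * (2 * d) ^ 3) +
          2 * ((μ * (2 * d) + 1 - evenDrift μ d) ^ 2 * C)) =
      (1 + 2 * d * growthRate μ σ d) * x + 2 * d * defectRate μ σ C d := by
  have h := one_add_sub_evenDrift hd
  have h2 : evenDrift μ d = μ * (2 * d) + 1 - d ^ 2 * driftDefect μ d := by linarith
  rw [h2, growthRate, defectRate]
  field_simp
  ring

end Coefficients

/-! ### Convergence of the scheme -/

section Convergence

variable {Ω : Type*} {mΩ : MeasurableSpace Ω} {P : Measure Ω}
  {ℱ : Filtration ℝ≥0 mΩ} {W X : ℝ≥0 → Ω → ℝ} {μ σ : ℝ} {T : ℝ≥0}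

theorem alphaFactor_eq (μ σ : ℝ) (dt : ℝ≥0) (n : ℕ) (ω : Ω) :
    alphaFactor μ σ dt W n ω = oddDrift μ dt +
      stepNoise W ((2 * n : ℕ) * dt) ((2 * n + 1 : ℕ) * dt) ((2 * n + 2 : ℕ) * dt)
        (oddMid μ σ dt) (oddEnd μ σ dt) ω := by
  simp only [alphaFactor, gridIncrement, stepNoise, oddDrift, oddMid, oddEnd, oddDenom]
  ring

theorem betaFactor_eq (μ σ : ℝ) (dt : ℝ≥0) (n : ℕ) (ω : Ω) :
    betaFactor μ σ dt W n ω = evenDrift μ dt +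
      stepNoise W ((2 * n : ℕ) * dt) ((2 * n + 1 : ℕ) * dt) ((2 * n + 2 : ℕ) * dt)
        (evenMid μ σ dt) (evenEnd μ σ dt) ω := by
  simp only [betaFactor, alphaFactor_eq, gridIncrement, stepNoise, evenDrift, evenMid, evenEnd]
  ring

theorem grid_mono (dt : ℝ≥0) {i j : ℕ} (hij : i ≤ j) : (i : ℝ≥0) * dt ≤ j * dt := by
  gcongr

theorem evenApprox_succ (μ σ : ℝ) (dt : ℝ≥0) (X₀ : Ω → ℝ) (n : ℕ) (ω : Ω) :
    evenApprox μ σ dt W X₀ (n + 1) ω = evenDrift μ dt * evenApprox μ σ dt W X₀ n ω +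
      stepNoise W ((2 * n : ℕ) * dt) ((2 * n + 1 : ℕ) * dt) ((2 * n + 2 : ℕ) * dt)
        (evenMid μ σ dt) (evenEnd μ σ dt) ω * evenApprox μ σ dt W X₀ n ω := by
  change betaFactor μ σ dt W n ω * _ = _
  rw [betaFactor_eq, add_mul]

theorem IsWienerProcess.stronglyMeasurable_evenApprox (hW : IsWienerProcess ℱ P W) (dt : ℝ≥0)
    {X₀ : Ω → ℝ} (hX₀ : StronglyMeasurable[ℱ 0] X₀) (n : ℕ) :
    StronglyMeasurable[ℱ ((2 * n : ℕ) * dt)] (evenApprox μ σ dt W X₀ n) := by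
  induction n with
  | zero =>
    have h0 : ((2 * 0 : ℕ) : ℝ≥0) * dt = 0 := by simp
    rw [h0]
    exact hX₀
  | succ n ih =>
    have e : evenApprox μ σ dt W X₀ (n + 1) = fun ω => _ :=
      funext fun ω => evenApprox_succ μ σ dt X₀ n ω
    rw [e]
    have h0 := grid_mono dt (show 2 * n ≤ 2 * (n + 1) by omega)
    have h1 := grid_mono dt (show 2 * n + 1 ≤ 2 * (n + 1) by omega)
    have ih' := ih.mono (ℱ.mono h0)
    exact (ih'.const_mul _).add ((((hW.stronglyMeasurable_increment h0 h1).const_mul _).add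
      ((hW.stronglyMeasurable_increment h0 le_rfl).const_mul _)).mul ih')

variable [IsProbabilityMeasure P]

theorem IsWienerProcess.memLp_evenApprox (hW : IsWienerProcess ℱ P W) (dt : ℝ≥0)
    {X₀ : Ω → ℝ} (hX₀ : StronglyMeasurable[ℱ 0] X₀) (hX₀2 : MemLp X₀ 2 P) (n : ℕ) :
    MemLp (evenApprox μ σ dt W X₀ n) 2 P := by
  induction n with
  | zero => exact hX₀2
  | succ n ih =>
    have e : evenApprox μ σ dt W X₀ (n + 1) = fun ω => _ :=
      funext fun ω => evenApprox_succ μ σ dt X₀ n ω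
    rw [e]
    exact (ih.const_mul _).add (hW.memLp_stepNoise_mul (grid_mono dt (Nat.le_succ _))
      (grid_mono dt (Nat.le_succ _)) _ _ (hW.stronglyMeasurable_evenApprox dt hX₀ n) ih)

/-- Discrete Gronwall: `n` double steps, each of which multiplies the bound by at most
`1 + 2 dt L` and adds `2 dt * defectRate μ σ C dt`. -/
theorem HasStepExpansion.meanSq_sub_evenApprox_le {C : ℝ}
    (h : HasStepExpansion ℱ P W X μ σ T C) (hW : IsWienerProcess ℱ P W) {dt : ℝ≥0}
    (hdt : 0 < dt) (hd : 1 - μ * dt / 3 ≠ 0) {L : ℝ} (hL0 : 0 ≤ L) (hL : growthRate μ σ dt ≤ L)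
    (n : ℕ) (hn : (2 * n : ℕ) * dt ≤ T) :
    meanSq P (fun ω => X ((2 * n : ℕ) * dt) ω - evenApprox μ σ dt W (X 0) n ω) ≤
      ENNReal.ofReal (n * (2 * dt * defectRate μ σ C dt) * (1 + 2 * dt * L) ^ n) := by
  have hC := h.nonneg
  have hr := defectRate_nonneg μ σ hC dt.2
  have hdt' : (0 : ℝ) < dt := by exact_mod_cast hdt
  induction n with
  | zero => simp [evenApprox, meanSq]
  | succ n ih =>
    have h0 := grid_mono dt (Nat.le_succ (2 * n))
    have h1 := grid_mono dt (Nat.le_succ (2 * n + 1))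
    have h2 := ih ((grid_mono dt (by omega)).trans hn)
    have hX₀ := h.measurable 0 zero_le
    have hlt : ((2 * n : ℕ) : ℝ≥0) * dt < ((2 * n + 2 : ℕ) : ℝ≥0) * dt := by
      gcongr
      omega
    have hstep := h.meanSq_step_le hW h0 h1 hn hlt (evenDrift μ dt) (evenMid μ σ dt)
      (evenEnd μ σ dt) (hW.stronglyMeasurable_evenApprox dt hX₀ n)
      (hW.memLp_evenApprox dt hX₀ (h.memLp zero_le) n) (by positivity) h2
    have hδ : (((2 * n + 2 : ℕ) : ℝ≥0) * dt : ℝ≥0) - (((2 * n : ℕ) : ℝ≥0) * dt : ℝ≥0) =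
        (2 * dt : ℝ) := by
      push_cast
      ring
    rw [hδ, stepBound_eq σ C _ hdt'.ne' hd] at hstep
    simp only [evenApprox_succ]
    refine hstep.trans (ENNReal.ofReal_le_ofReal ?_)
    set ρ : ℝ := 2 * dt * defectRate μ σ C dt
    have hρ : 0 ≤ ρ := by positivity
    have hκ : 1 ≤ 1 + 2 * dt * L := by
      have : 0 ≤ 2 * dt * L := by positivity
      linarith
    calc (1 + 2 * dt * growthRate μ σ dt) * (n * ρ * (1 + 2 * dt * L) ^ n) + ρ
        ≤ (1 + 2 * dt * L) * (n * ρ * (1 + 2 * dt * L) ^ n) + ρ * (1 + 2 * dt * L) ^ (n + 1) := by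
          gcongr
          exact le_mul_of_one_le_right hρ (one_le_pow₀ hκ)
      _ = _ := by
          push_cast
          ring

/-- The bound for the error at even nodes, uniform in the node. -/
noncomputable def evenBound (μ σ C T L d : ℝ) : ℝ := T * defectRate μ σ C d * Real.exp (L * T)

/-- The bound for the error at odd nodes, uniform in the node. -/
noncomputable def oddBound (μ σ C T L d : ℝ) : ℝ :=
  2 * (2 * (C * (2 * d)) + 2 * ((1 - oddDrift μ d) ^ 2 * C)) +
    2 * (2 * (oddDrift μ d ^ 2 * evenBound μ σ C T L d) +
      2 * (2 * (oddMid μ σ d ^ 2 + oddEnd μ σ d ^ 2) * (2 * d) *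
        (2 * C + 2 * evenBound μ σ C T L d)))

theorem tendsto_evenBound (μ σ C T L : ℝ) : Tendsto (evenBound μ σ C T L) (𝓝 0) (𝓝 0) := by
  unfold evenBound
  simpa using ((tendsto_defectRate μ σ C).const_mul T).mul_const (Real.exp (L * T))

theorem tendsto_oddBound (μ σ C T L : ℝ) : Tendsto (oddBound μ σ C T L) (𝓝 0) (𝓝 0) := by
  have hE := tendsto_evenBound μ σ C T L
  have h1 : Tendsto (oddDrift μ) (𝓝 0) (𝓝 1) := by
    simpa [oddDrift, oddDenom] using (continuousAt_oddDrift μ).tendsto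
  have h2 := (continuousAt_oddMid μ σ).tendsto
  have h3 := (continuousAt_oddEnd μ σ).tendsto
  have hid : Tendsto (fun d : ℝ => 2 * d) (𝓝 0) (𝓝 0) := by
    simpa using (tendsto_id (α := ℝ) (x := 𝓝 0)).const_mul 2
  have := (((hid.const_mul C).const_mul 2).add ((((h1.const_sub 1).pow 2).mul_const C).const_mul
    2)).const_mul 2 |>.add (((((h1.pow 2).mul hE).const_mul 2).add
    (((((h2.pow 2).add (h3.pow 2)).const_mul 2).mul hid).mul
      ((hE.const_mul 2).const_add (2 * C)) |>.const_mul 2)).const_mul 2)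
  unfold oddBound
  simpa using this

theorem HasStepExpansion.meanSq_sub_evenApprox_le_evenBound {C : ℝ}
    (h : HasStepExpansion ℱ P W X μ σ T C) (hW : IsWienerProcess ℱ P W) {dt : ℝ≥0}
    (hdt : 0 < dt) (hd : 1 - μ * dt / 3 ≠ 0) {L : ℝ} (hL0 : 0 ≤ L) (hL : growthRate μ σ dt ≤ L)
    (n : ℕ) (hn : (2 * n : ℕ) * dt ≤ T) :
    meanSq P (fun ω => X ((2 * n : ℕ) * dt) ω - evenApprox μ σ dt W (X 0) n ω) ≤
      ENNReal.ofReal (evenBound μ σ C T L dt) := by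
  refine (h.meanSq_sub_evenApprox_le hW hdt hd hL0 hL n hn).trans (ENNReal.ofReal_le_ofReal ?_)
  have hr := defectRate_nonneg μ σ h.nonneg dt.2
  have hn' : (n : ℝ) * (2 * dt) ≤ T := by
    have : (((2 * n : ℕ) * dt : ℝ≥0) : ℝ) ≤ T := by exact_mod_cast hn
    push_cast at this
    linarith
  have hexp : (1 + 2 * dt * L) ^ n ≤ Real.exp (L * T) := by
    have hnn : (0 : ℝ) ≤ 2 * dt * L := by positivity
    calc (1 + 2 * dt * L) ^ n ≤ Real.exp (2 * dt * L) ^ n := by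
          gcongr
          linarith [Real.add_one_le_exp (2 * dt * L)]
      _ = Real.exp (L * (n * (2 * dt))) := by
          rw [← Real.exp_nat_mul]
          congr 1
          ring
      _ ≤ _ := by gcongr
  have hpow : (0 : ℝ) ≤ (1 + 2 * dt * L) ^ n := by positivity
  calc (n : ℝ) * (2 * dt * defectRate μ σ C dt) * (1 + 2 * dt * L) ^ n
      = n * (2 * dt) * defectRate μ σ C dt * (1 + 2 * dt * L) ^ n := by ring
    _ ≤ T * defectRate μ σ C dt * Real.exp (L * T) := by gcongr

theorem HasStepExpansion.meanSq_sub_approx_le {C : ℝ}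
    (h : HasStepExpansion ℱ P W X μ σ T C) (hW : IsWienerProcess ℱ P W) {dt : ℝ≥0}
    (hdt : 0 < dt) (hd : 1 - μ * dt / 3 ≠ 0) {L : ℝ} (hL0 : 0 ≤ L) (hL : growthRate μ σ dt ≤ L)
    {M : ℕ} (hM : (2 * M : ℕ) * dt = T) (i : ℕ) (hi : i ≤ 2 * M) :
    meanSq P (fun ω => X (i * dt) ω - approx μ σ dt W (X 0) i ω) ≤
      ENNReal.ofReal (evenBound μ σ C T L dt + oddBound μ σ C T L dt) := by
  have hC := h.nonneg
  have hr := defectRate_nonneg μ σ hC dt.2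
  have hE0 : 0 ≤ evenBound μ σ C T L dt := by
    unfold evenBound
    positivity
  have hO0 : 0 ≤ oddBound μ σ C T L dt := by
    unfold oddBound
    positivity
  rcases Nat.even_or_odd' i with ⟨n, rfl | rfl⟩
  · have hn : (2 * n : ℕ) * dt ≤ T := hM ▸ grid_mono dt hi
    have e : ∀ ω, approx μ σ dt W (X 0) (2 * n) ω = evenApprox μ σ dt W (X 0) n ω := by
      simp [approx]
    simp only [e]
    exact (h.meanSq_sub_evenApprox_le_evenBound hW hdt hd hL0 hL n hn).trans
      (ENNReal.ofReal_le_ofReal (le_add_of_nonneg_right hO0))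
  · have hn : (2 * n : ℕ) * dt ≤ T := hM ▸ grid_mono dt (by omega)
    have hn2 : (2 * n + 2 : ℕ) * dt ≤ T := hM ▸ grid_mono dt (by omega)
    have e : ∀ ω, approx μ σ dt W (X 0) (2 * n + 1) ω =
        oddDrift μ dt * evenApprox μ σ dt W (X 0) n ω +
          stepNoise W ((2 * n : ℕ) * dt) ((2 * n + 1 : ℕ) * dt) ((2 * n + 2 : ℕ) * dt)
            (oddMid μ σ dt) (oddEnd μ σ dt) ω * evenApprox μ σ dt W (X 0) n ω := by
      intro ω
      have h1 : ¬Even (2 * n + 1) := by simp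
      have h2 : (2 * n + 1) / 2 = n := by omega
      rw [approx, if_neg h1, h2, alphaFactor_eq, add_mul]
    simp only [e]
    have hX₀ := h.measurable 0 zero_le
    have hstep := h.meanSq_intermediate_le hW (grid_mono dt (Nat.le_succ (2 * n)))
      (grid_mono dt (Nat.le_succ (2 * n + 1))) hn2 (oddDrift μ dt) (oddMid μ σ dt)
      (oddEnd μ σ dt) (hW.stronglyMeasurable_evenApprox dt hX₀ n)
      (hW.memLp_evenApprox dt hX₀ (h.memLp zero_le) n) hE0
      (h.meanSq_sub_evenApprox_le_evenBound hW hdt hd hL0 hL n hn)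
    have hδ : (((2 * n + 2 : ℕ) : ℝ≥0) * dt : ℝ≥0) - (((2 * n : ℕ) : ℝ≥0) * dt : ℝ≥0) =
        (2 * dt : ℝ) := by
      push_cast
      ring
    simp only [Nat.succ_eq_add_one, add_assoc, Nat.reduceAdd, hδ] at hstep
    exact hstep.trans (ENNReal.ofReal_le_ofReal (le_add_of_nonneg_left hE0))

end Convergence

end QuadraticScheme

theorem mainTheorem3 {Ω : Type*} {mΩ : MeasurableSpace Ω} (P : Measure Ω) [IsProbabilityMeasure P]
    (ℱ : Filtration ℝ≥0 mΩ) (W X : ℝ≥0 → Ω → ℝ) (μ σ : ℝ) (T : ℝ≥0) (hT : 0 < T)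
    (hW : QuadraticScheme.IsWienerProcess ℱ P W)
    (hX : QuadraticScheme.IsItoSolution ℱ P W (fun _ x => μ * x) (fun _ x => σ * x) T X)
    (hX₀ : MemLp (X 0) 2 P) :
    Tendsto (fun M : ℕ => QuadraticScheme.maxMeanSquareError P μ σ T W X (2 * M))
      atTop (𝓝 0) := by
  open QuadraticScheme in
  obtain ⟨C, h⟩ := hX.exists_hasStepExpansion hW hX₀
  -- a bound for the growth rate at all small step sizes
  set L : ℝ := |growthRate μ σ 0| + 1
  set d : ℕ → ℝ≥0 := fun M => T / (2 * M : ℕ)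
  have hd0 : Tendsto (fun M => (d M : ℝ)) atTop (𝓝 0) := by
    have h1 : Tendsto (fun M : ℕ => ((2 * M : ℕ) : ℝ)) atTop atTop :=
      tendsto_natCast_atTop_atTop.comp (tendsto_id.const_mul_atTop' (by norm_num))
    simpa only [d, NNReal.coe_div, NNReal.coe_natCast] using h1.const_div_atTop (T : ℝ)
  have hgrowth : ∀ᶠ M in atTop, growthRate μ σ (d M) ≤ L := by
    refine hd0.eventually (((continuousAt_growthRate μ σ).tendsto.eventually_lt_const
      (u := L) ?_).mono fun _ h => h.le)
    exact (le_abs_self _).trans_lt (lt_add_one _)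
  -- for large `M` the denominator of `β n` does not vanish
  have hpos : ∀ᶠ M in atTop, 1 - μ * (d M) / 3 ≠ 0 := by
    have hc : ContinuousAt (fun x : ℝ => 1 - μ * x / 3) 0 := by fun_prop
    exact hd0.eventually (hc.eventually_ne (by norm_num))
  have hlim : Tendsto (fun M => ENNReal.ofReal
      (evenBound μ σ C T L (d M) + oddBound μ σ C T L (d M))) atTop (𝓝 0) := by
    have h1 := ((tendsto_evenBound μ σ C T L).add (tendsto_oddBound μ σ C T L)).comp hd0
    simpa using ENNReal.tendsto_ofReal h1
  refine tendsto_of_tendsto_of_tendsto_of_le_of_le' tendsto_const_nhds hlim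
    (Eventually.of_forall fun _ => zero_le) ?_
  filter_upwards [hgrowth, hpos, eventually_gt_atTop 0] with M h1 h2 h3
  have hM : ((2 * M : ℕ) : ℝ≥0) ≠ 0 := by
    simp only [ne_eq, Nat.cast_eq_zero]
    omega
  refine iSup₂_le fun i hi => ?_
  exact h.meanSq_sub_approx_le hW (div_pos hT (pos_iff_ne_zero.2 hM)) h2 (by positivity) h1
    (mul_div_cancel₀ T hM) i (Nat.lt_succ_iff.1 (Finset.mem_range.1 hi))
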